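/- Let $s\in\mathbb Z$ and let $S=\{0,1,\dots,2s\}$ or $S=\mathbb Z$. Let $X(t)$, $t\ge 0$, be a homogeneous continuous-time Markov chain with state space $S$ whose sample paths are almost surely right-continuous step functions (finitely many jumps in every bounded time interval). Write $p_{k,n}(t)=\mathrm P\{X(t)=n\mid X(0)=k\}$ and assume that the rates $q_{k,n}=\frac{d}{dt}p_{k,n}(t)\big|_{t=0^+}$ exist and are finite, with $q_{k,n}\ge 0$ for $k\ne n$, $q_{n,n}\le 0$ and $\sum_{n\in S}q_{k,n}=0$. Put $S_-=\{n\in S: n<s\}$ and $S_+=\{n\in S: n>s\}$, and assume: - (central symmetry) for some positive reals $x_n$ ($n\in S$), $p_{2s-k,2s-n}(t)=\dfrac{x_n}{x_k}\,p_{k,n}(t)$ for all $k,n\in S$ and $t\ge 0$; - $q_{i,j}=q_{j,i}=0$ for all $i\in S_-$, $j\in S_+$, and the sums $\sum_{i\in S_-}q_{i,s}$, $\sum_{j\in S_+}q_{j,s}$, $\sum_{i\in S_-}q_{s,i}$, $\sum_{j\in S_+}q_{s,j}$ (possibly infinite) are positive; - the subchains on $S_-$ and on $S_+$ are irreducible,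 that is, within each of these two sets any state leads to any other through a finite sequence of transitions of positive rate inside that set. Then, for all $k\in S$ and $t>0$, the probability currents $$h^+_{k,s}(t)=\lim_{\tau\downarrow0}\frac1\tau \mathrm P\{X(t+\tau)=s,\,X(t)<s\mid X(0)=k\}=\sum_{i\in S_-}p_{k,i}(t)\,q_{i,s},$$ $$h^-_{k,s}(t)=\lim_{\tau\downarrow0}\frac1\tau \mathrm P\{X(t+\tau)=s,\,X(t)>s\mid X(0)=k\}=\sum_{j\in S_+}p_{k,j}(t)\,q_{j,s}$$ are well defined (the limits exist, the series converge, and the equalities hold), and $$h^-_{2s-k,s}(t)=\frac{x_s}{x_k}\,h^+_{k,s}(t).$$ Moreover, for $i\in S_-$ the first-passage time $\inf\{t\ge 0: X(t)=s\}$ of the chain started at $i$ has a (possibly defective) density $g^+_{i,s}$ on $(0,\infty)$, and for $j\in S_+$ that of the chain started at $j$ has a (possibly defective) density $g^-_{j,s}$ on $(0,\infty)$; these densities are continuous, are the derivatives of the respective distribution functions, and for all $t>0$ $$g^+_{i,s}(t)=h^+_{i,s}(t)-h^-_{i,s}(t),\qquad g^-_{j,s}(t)=h^-_{j,s}(t)-h^+_{j,s}(t).$$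 -/

import Mathlib

open MeasureTheory Filter Topology Set

/-- A path `ℝ → ℤ`, looked at on `[0, ∞)`, that is a step function: right-continuous with left
limits in the discrete space `ℤ`. Equivalently, it is right-continuous and piecewise constant with
finitely many jumps in each bounded time interval. -/
def IsStepPath (w : ℝ → ℤ) : Prop :=
  (∀ t, 0 ≤ t → ∀ᶠ u in 𝓝[>] t, w u = w t) ∧
    ∀ t, 0 < t → ∃ n : ℤ, ∀ᶠ u in 𝓝[<] t, w u = n

/-- A homogeneous continuous-time Markov chain `X(t)`, `t ≥ 0`, with state space `S ⊆ ℤ`.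
`P k` is the conditional law given `X(0) = k`. Only times `t ≥ 0` and initial states `k ∈ S`
are relevant. -/
structure MarkovChain (Ω : Type*) [MeasurableSpace Ω] (S : Set ℤ) where
  /-- the process -/
  X : ℝ → Ω → ℤ
  /-- the law of the chain started at `k` -/
  P : ℤ → Measure Ω
  measurable_X : ∀ t, 0 ≤ t → Measurable (X t)
  isProbabilityMeasure : ∀ k ∈ S, IsProbabilityMeasure (P k)
  start : ∀ k ∈ S, ∀ᵐ ω ∂(P k), X 0 ω = k
  mem_state : ∀ k ∈ S, ∀ᵐ ω ∂(P k), ∀ t, 0 ≤ t → X t ω ∈ S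
  step_path : ∀ k ∈ S, ∀ᵐ ω ∂(P k), IsStepPath fun t => X t ω
  /-- Markov property and homogeneity: given the past up to time `t` and `X(t) = m`, the
  probability of `X(t + u) = n` is that of `X(u) = n` for the chain started at `m`. -/
  markov : ∀ k ∈ S, ∀ m ∈ S, ∀ n ∈ S, ∀ t u : ℝ, 0 ≤ t → 0 ≤ u → ∀ A : Set Ω,
    MeasurableSet[⨆ r ∈ Icc (0 : ℝ) t, MeasurableSpace.comap (X r) ⊤] A →
    P k (A ∩ {ω | X t ω = m} ∩ {ω | X (t + u) ω = n}) =
      P k (A ∩ {ω | X t ω = m}) * P m {ω | X u ω = n}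

namespace MarkovChain

variable {Ω : Type*} [MeasurableSpace Ω] {S : Set ℤ}

/-- The transition probability `p_{k,n}(t) = P(X(t) = n | X(0) = k)`. -/
noncomputable def p (M : MarkovChain Ω S) (k n : ℤ) (t : ℝ) : ℝ :=
  (M.P k).real {ω | M.X t ω = n}

/-- The transition rate `q_{k,n}`: the (right) derivative of `p_{k,n}` at `0`. -/
noncomputable def q (M : MarkovChain Ω S) (k n : ℤ) : ℝ :=
  derivWithin (M.p k n) (Ici 0) 0

/-- The infinitesimal generator has finite entries and is conservative. -/
structure HasGenerator (M : MarkovChain Ω S) : Prop where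
  differentiable : ∀ k ∈ S, ∀ n ∈ S, DifferentiableWithinAt ℝ (M.p k n) (Ici 0) 0
  offDiag_nonneg : ∀ k ∈ S, ∀ n ∈ S, k ≠ n → 0 ≤ M.q k n
  diag_nonpos : ∀ n ∈ S, M.q n n ≤ 0
  row_sum : ∀ k ∈ S, HasSum (fun n : S => M.q k n) 0

/-- Central symmetry with respect to `N / 2`, with positive weights `x`:
`p_{N-k,N-n}(t) = (x_n / x_k) p_{k,n}(t)`. -/
def CentralSymmetry (M : MarkovChain Ω S) (N : ℤ) (x : ℤ → ℝ) : Prop :=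
  (∀ n ∈ S, 0 < x n) ∧
    ∀ k ∈ S, ∀ n ∈ S, ∀ t : ℝ, 0 ≤ t → M.p (N - k) (N - n) t = x n / x k * M.p k n t

end MarkovChain

/-- The part `S₋` of the state space below `s`. -/
def below (S : Set ℤ) (s : ℤ) : Set ℤ := {n | n ∈ S ∧ n < s}

/-- The part `S₊` of the state space above `s`. -/
def above (S : Set ℤ) (s : ℤ) : Set ℤ := {n | n ∈ S ∧ s < n}

namespace MarkovChain

variable {Ω : Type*} [MeasurableSpace Ω] {S : Set ℤ}

/-- No direct transitions between `S₋` and `S₊`, while `s` can be entered from, and left to, either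
side. The sums of rates into `s` may be infinite, so all four are taken in `[0, ∞]`. -/
structure Separates (M : MarkovChain Ω S) (s : ℤ) : Prop where
  no_jump : ∀ i ∈ below S s, ∀ j ∈ above S s, M.q i j = 0 ∧ M.q j i = 0
  enter_below : 0 < ∑' i : below S s, ENNReal.ofReal (M.q i s)
  enter_above : 0 < ∑' j : above S s, ENNReal.ofReal (M.q j s)
  exit_below : 0 < ∑' i : below S s, ENNReal.ofReal (M.q s i)
  exit_above : 0 < ∑' j : above S s, ENNReal.ofReal (M.q s j)

/-- The subchain on `A` (transitions inside `A` only) is irreducible: any state of `A` leads to any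
other one through a finite sequence of transitions inside `A` with positive rates. -/
def IrreducibleOn (M : MarkovChain Ω S) (A : Set ℤ) : Prop :=
  ∀ i ∈ A, ∀ j ∈ A, Relation.ReflTransGen (fun a b => a ∈ A ∧ b ∈ A ∧ 0 < M.q a b) i j

/-- The upward probability current `h⁺_{k,s}(t)`. -/
noncomputable def hUp (M : MarkovChain Ω S) (k s : ℤ) (t : ℝ) : ℝ :=
  ∑' i : below S s, M.p k i t * M.q i s

/-- The downward probability current `h⁻_{k,s}(t)`. -/
noncomputable def hDown (M : MarkovChain Ω S) (k s : ℤ) (t : ℝ) : ℝ :=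
  ∑' j : above S s, M.p k j t * M.q j s

/-- The first-passage time through `s`, equal to `∞` if `s` is never visited. -/
noncomputable def passageTime (M : MarkovChain Ω S) (s : ℤ) (ω : Ω) : ENNReal :=
  ⨅ t ∈ {t : ℝ | 0 ≤ t ∧ M.X t ω = s}, ENNReal.ofReal t

/-- The distribution function of the first-passage time from `k` to `s`. -/
noncomputable def passageCDF (M : MarkovChain Ω S) (k s : ℤ) (t : ℝ) : ℝ :=
  (M.P k).real {ω | M.passageTime s ω ≤ ENNReal.ofReal t}

/-- The first-passage density `g_{k,s}(t)` (upward for `k < s`, downward for `k > s`): the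
derivative of the distribution function of the first-passage time from `k` to `s`. -/
noncomputable def g (M : MarkovChain Ω S) (k s : ℤ) (t : ℝ) : ℝ :=
  deriv (M.passageCDF k s) t

/-- `f` is a continuous version on `(0, ∞)` of the (possibly defective) probability density of the
first-passage time from `k` to `s`. It is determined on `(0, ∞)` by this property. -/
structure IsPassageDensity (M : MarkovChain Ω S) (k s : ℤ) (f : ℝ → ℝ) : Prop where
  continuousOn : ContinuousOn f (Ioi 0)
  nonneg : ∀ t, 0 < t → 0 ≤ f t
  cdf_eq : ∀ t, 0 ≤ t → ENNReal.ofReal (M.passageCDF k s t) =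
    ∫⁻ u in Ioc 0 t, ENNReal.ofReal (f u)

end MarkovChain

/-! Fix a start k on the side C of s, let C' be the other side, and compare the fluxes P(X(t) ∈ C,
X(t+τ) = s) and P(X(t) ∈ C', X(t+τ) = s), splitting by whether s was visited up to time t. After a
visit the two contributions agree: restart at the first visit, and use that the symmetry weights
cancel in p_{s,n}(u) p_{n,s}(τ) (`flux_reflect`, `measure_visits_inter_flux_le`). Without a visit
the chain is almost surely still in C, because jumps across s have rate zero
(`measure_compl_visits_inter_eq_zero`). Hence the difference of the fluxes is exactly the
probability of no visit up to t followed by X(t+τ) = s (`measureReal_compl_visits_inter`). To first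
order in τ this is the increment of the passage distribution function, since a chain that enters s
during [t, t+τ] is still there at the end with probability 1 − O(τ). Division by τ gives the right
derivative of that function as a difference of currents; it is continuous, so the fundamental
theorem of calculus makes it the density.

The analytic work is the limit of flux/τ. The rates into s may be unbounded, so limit and sum cannot
be exchanged by simple domination. The backward equation (`tendsto_p_slope`) gives the limit of the
total flux from {s}ᶜ in a visibly continuous form. A Fatou argument bounds the sum of the currents
by this limit. Equality, the forward equation `hasSum_inflow`, holds because step paths visit
finitely many states in bounded time, which makes entries into s from remote states negligible
uniformly over dyadic meshes. Scheffé's lemma then passes from the total flux to the flux from one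
side, and also yields continuity of the currents. -/

theorem measure_eq_tsum_fiber {Ω : Type*} [MeasurableSpace Ω] (μ : Measure Ω)
    {f : Ω → ℤ} (hf : Measurable f) (W : Set Ω) :
    μ W = ∑' n, μ (W ∩ {ω | f ω = n}) := by
  have hm : ∀ n, MeasurableSet {ω | f ω = n} := fun n => hf (measurableSet_singleton n)
  -- Restricting to `W` leaves only the fibres to be measurable; `W` is arbitrary.
  have h := measure_iUnion (μ := μ.restrict W) (f := fun n : ℤ => {ω | f ω = n})
    (fun i j hij => Set.disjoint_left.2 fun ω hi hj => hij (hi.symm.trans hj)) hm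
  have hU : (⋃ n : ℤ, {ω | f ω = n}) = univ := by ext; simp
  rw [hU, Measure.restrict_apply_univ] at h
  rw [h]
  exact tsum_congr fun n => by rw [Measure.restrict_apply (hm n), inter_comm]

theorem hasSum_measureReal_fiber {Ω : Type*} [MeasurableSpace Ω] (μ : Measure Ω)
    [IsFiniteMeasure μ] {f : Ω → ℤ} (hf : Measurable f) (W : Set Ω) :
    HasSum (fun n => μ.real (W ∩ {ω | f ω = n})) (μ.real W) := by
  have h := measure_eq_tsum_fiber μ hf W
  have hne : ∑' n, μ (W ∩ {ω | f ω = n}) ≠ ⊤ := h ▸ measure_ne_top μ W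
  have h2 := ENNReal.hasSum_toReal hne
  rwa [← ENNReal.tsum_toReal_eq fun n => measure_ne_top μ _, ← h] at h2

/-! ### Transition probabilities, fluxes and the Markov property -/

namespace MarkovChain

variable {Ω : Type*} [MeasurableSpace Ω] {S : Set ℤ} (M : MarkovChain Ω S)

/-- The σ-algebra of the past up to time `t`. -/
abbrev past (t : ℝ) : MeasurableSpace Ω :=
  ⨆ r ∈ Icc (0 : ℝ) t, MeasurableSpace.comap (M.X r) ⊤

theorem measurableSet_past {r t : ℝ} (hr : 0 ≤ r) (hrt : r ≤ t) (C : Set ℤ) :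
    MeasurableSet[M.past t] {ω | M.X r ω ∈ C} := by
  have h : MeasurableSpace.comap (M.X r) ⊤ ≤ M.past t :=
    le_iSup₂_of_le (f := fun r (_ : r ∈ Icc (0 : ℝ) t) => MeasurableSpace.comap (M.X r) ⊤)
      r ⟨hr, hrt⟩ le_rfl
  exact h _ ⟨C, trivial, rfl⟩

theorem past_mono {t u : ℝ} (h : t ≤ u) : M.past t ≤ M.past u :=
  iSup₂_le fun r hr => le_iSup₂_of_le
    (f := fun r (_ : r ∈ Icc (0 : ℝ) u) => MeasurableSpace.comap (M.X r) ⊤)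
    r ⟨hr.1, hr.2.trans h⟩ le_rfl

theorem past_le (t : ℝ) : M.past t ≤ ‹MeasurableSpace Ω› :=
  iSup₂_le fun r hr => (M.measurable_X r hr.1).comap_le

theorem measurableSet_X {t : ℝ} (ht : 0 ≤ t) (C : Set ℤ) : MeasurableSet {ω | M.X t ω ∈ C} :=
  M.measurable_X t ht (MeasurableSet.of_discrete (s := C))

/-- The probability of being in `C` at time `t` and at `s` after a further time `τ`. -/
noncomputable def flux (k : ℤ) (C : Set ℤ) (s : ℤ) (t τ : ℝ) : ℝ :=
  (M.P k).real {ω | M.X t ω ∈ C ∧ M.X (t + τ) ω = s}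

theorem measurableSet_flux (C : Set ℤ) (s : ℤ) {t τ : ℝ} (ht : 0 ≤ t) (hτ : 0 ≤ τ) :
    MeasurableSet {ω | M.X t ω ∈ C ∧ M.X (t + τ) ω = s} :=
  (M.measurableSet_X ht C).inter (M.measurableSet_X (add_nonneg ht hτ) {s})

variable {M} {k : ℤ}

theorem measure_X_eq_zero (hk : k ∈ S) {n : ℤ} (hn : n ∉ S) {t : ℝ} (ht : 0 ≤ t) :
    M.P k {ω | M.X t ω = n} = 0 :=
  measure_eq_zero_iff_ae_notMem.2 <| (M.mem_state k hk).mono fun _ h hω => hn (hω ▸ h t ht)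

theorem p_eq_zero (hk : k ∈ S) {n : ℤ} (hn : n ∉ S) {t : ℝ} (ht : 0 ≤ t) : M.p k n t = 0 := by
  simp [p, Measure.real, measure_X_eq_zero hk hn ht]

theorem p_nonneg (n : ℤ) (t : ℝ) : 0 ≤ M.p k n t := measureReal_nonneg

theorem p_le_one (hk : k ∈ S) (n : ℤ) (t : ℝ) : M.p k n t ≤ 1 :=
  have := M.isProbabilityMeasure k hk
  measureReal_le_one

theorem p_zero_self (hk : k ∈ S) : M.p k k 0 = 1 := by
  have := M.isProbabilityMeasure k hk
  have h : M.P k {ω | M.X 0 ω = k} = 1 :=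
    (prob_compl_eq_zero_iff (M.measurableSet_X le_rfl {k})).1 (M.start k hk)
  simp [p, Measure.real, h]

theorem p_zero_of_ne (hk : k ∈ S) {n : ℤ} (hn : n ≠ k) : M.p k n 0 = 0 := by
  have h : M.P k {ω | M.X 0 ω = n} = 0 :=
    measure_eq_zero_iff_ae_notMem.2 <| (M.start k hk).mono fun _ h hω => hn (hω.symm.trans h)
  simp [p, Measure.real, h]

theorem hasSum_p (hk : k ∈ S) {t : ℝ} (ht : 0 ≤ t) : HasSum (fun n => M.p k n t) 1 := by
  have := M.isProbabilityMeasure k hk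
  simpa [p] using hasSum_measureReal_fiber (M.P k) (M.measurable_X t ht) univ

/-- The Markov property for an event involving two future times. -/
theorem markov_flux (hk : k ∈ S) {m s : ℤ} (hm : m ∈ S) (hs : s ∈ S) {t u τ : ℝ} (ht : 0 ≤ t)
    (hu : 0 ≤ u) (hτ : 0 ≤ τ) {A : Set Ω} (hA : MeasurableSet[M.past t] A) (C : Set ℤ) :
    M.P k (A ∩ {ω | M.X t ω = m} ∩ {ω | M.X (t + u) ω ∈ C ∧ M.X (t + u + τ) ω = s}) =
      M.P k (A ∩ {ω | M.X t ω = m}) * M.P m {ω | M.X u ω ∈ C ∧ M.X (u + τ) ω = s} := by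
  have htu := add_nonneg ht hu
  -- Split both sides by the value `n` at the intermediate time; only `n ∈ C ∩ S` contributes.
  rw [measure_eq_tsum_fiber _ (M.measurable_X (t + u) htu), measure_eq_tsum_fiber (M.P m)
    (M.measurable_X u hu), ← ENNReal.tsum_mul_left]
  refine tsum_congr fun n => ?_
  by_cases hn : n ∈ C
  · by_cases hnS : n ∈ S
    · have hA' : MeasurableSet[M.past (t + u)] (A ∩ {ω | M.X t ω = m}) :=
        MeasurableSet.inter (M.past_mono (by linarith) _ hA)
          (M.measurableSet_past ht (by linarith) {m})
      have e1 : A ∩ {ω | M.X t ω = m} ∩ {ω | M.X (t + u) ω ∈ C ∧ M.X (t + u + τ) ω = s} ∩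
          {ω | M.X (t + u) ω = n} = A ∩ {ω | M.X t ω = m} ∩ {ω | M.X (t + u) ω = n} ∩
            {ω | M.X (t + u + τ) ω = s} := by
        ext ω
        simp only [mem_inter_iff, mem_ofPred_eq]
        grind
      have e2 : {ω | M.X u ω ∈ C ∧ M.X (u + τ) ω = s} ∩ {ω | M.X u ω = n} =
          univ ∩ {ω | M.X u ω = n} ∩ {ω | M.X (u + τ) ω = s} := by
        ext ω
        simp only [mem_inter_iff, mem_ofPred_eq, mem_univ]
        grind
      rw [e1, e2, M.markov k hk n hnS s hs (t + u) τ htu hτ _ hA',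
        M.markov k hk m hm n hnS t u ht hu _ hA,
        M.markov m hm n hnS s hs u τ hu hτ _ MeasurableSet.univ, univ_inter, mul_assoc]
    · rw [measure_mono_null inter_subset_right (measure_X_eq_zero hk hnS htu),
        measure_mono_null inter_subset_right (measure_X_eq_zero hm hnS hu), mul_zero]
  · have e1 : A ∩ {ω | M.X t ω = m} ∩ {ω | M.X (t + u) ω ∈ C ∧ M.X (t + u + τ) ω = s} ∩
        {ω | M.X (t + u) ω = n} = ∅ := by
      ext ω
      simp only [mem_inter_iff, mem_ofPred_eq, mem_empty_iff_false]
      grind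
    have e2 : {ω | M.X u ω ∈ C ∧ M.X (u + τ) ω = s} ∩ {ω | M.X u ω = n} = ∅ := by
      ext ω
      simp only [mem_inter_iff, mem_ofPred_eq, mem_empty_iff_false]
      grind
    rw [e1, e2]
    simp

/-- Chapman–Kolmogorov with the intermediate state confined to `C`. States of `C` outside `S` carry
no mass, so `C` may be a half-line of integers. -/
theorem hasSum_flux (hk : k ∈ S) {s : ℤ} (hs : s ∈ S) (C : Set ℤ) {t τ : ℝ} (ht : 0 ≤ t)
    (hτ : 0 ≤ τ) :
    HasSum (C.indicator fun n => M.p k n t * M.p n s τ) (M.flux k C s t τ) := by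
  have := M.isProbabilityMeasure k hk
  unfold flux
  convert hasSum_measureReal_fiber (M.P k) (M.measurable_X t ht)
    {ω | M.X t ω ∈ C ∧ M.X (t + τ) ω = s} using 2 with n
  by_cases hn : n ∈ C
  · have e : {ω | M.X t ω ∈ C ∧ M.X (t + τ) ω = s} ∩ {ω | M.X t ω = n} =
        univ ∩ {ω | M.X t ω = n} ∩ {ω | M.X (t + τ) ω = s} := by
      ext ω
      simp only [mem_inter_iff, mem_ofPred_eq, mem_univ]
      grind
    rw [indicator_of_mem hn, e]
    by_cases hnS : n ∈ S
    · rw [Measure.real, M.markov k hk n hnS s hs t τ ht hτ _ MeasurableSet.univ, univ_inter,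
        ENNReal.toReal_mul]
      rfl
    · rw [p_eq_zero hk hnS ht, zero_mul, Measure.real, measure_mono_null
        (inter_subset_left.trans inter_subset_right) (measure_X_eq_zero hk hnS ht)]
      rfl
  · have e : {ω | M.X t ω ∈ C ∧ M.X (t + τ) ω = s} ∩ {ω | M.X t ω = n} = ∅ := by
      ext ω
      simp only [mem_inter_iff, mem_ofPred_eq, mem_empty_iff_false]
      grind
    rw [indicator_of_notMem hn, e, measureReal_empty]

theorem flux_nonneg (C : Set ℤ) (s : ℤ) (t τ : ℝ) : 0 ≤ M.flux k C s t τ := measureReal_nonneg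

theorem flux_univ (s : ℤ) (t τ : ℝ) : M.flux k univ s t τ = M.p k s (t + τ) := by
  simp [flux, p]

theorem hasSum_p_add (hk : k ∈ S) {s : ℤ} (hs : s ∈ S) {t τ : ℝ} (ht : 0 ≤ t) (hτ : 0 ≤ τ) :
    HasSum (fun n => M.p k n t * M.p n s τ) (M.p k s (t + τ)) := by
  simpa [flux_univ] using hasSum_flux hk hs univ ht hτ

theorem flux_compl_singleton (hk : k ∈ S) {m s : ℤ} (hs : s ∈ S) {t τ : ℝ}
    (ht : 0 ≤ t) (hτ : 0 ≤ τ) :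
    M.flux k {m}ᶜ s t τ = M.p k s (t + τ) - M.p k m t * M.p m s τ := by
  refine (hasSum_flux hk hs ({m}ᶜ) ht hτ).unique ?_
  have e : (({m}ᶜ : Set ℤ).indicator fun n => M.p k n t * M.p n s τ) =
      fun n => M.p k n t * M.p n s τ - if n = m then M.p k m t * M.p m s τ else 0 := by
    funext n
    by_cases h : n = m
    · subst h; simp
    · simp [h]
  rw [e]
  exact (hasSum_p_add hk hs ht hτ).sub (hasSum_ite_eq m _)

/-- Waiting at the initial state for a time `v` gives a lower bound for the flux. -/
theorem mul_flux_le (hk : k ∈ S) {s : ℤ} (hs : s ∈ S) (C : Set ℤ) {t τ v : ℝ} (ht : 0 ≤ t)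
    (hτ : 0 ≤ τ) (hv : 0 ≤ v) :
    M.p k k v * M.flux k C s t τ ≤ M.flux k C s (v + t) τ := by
  have := M.isProbabilityMeasure k hk
  have h := markov_flux (M := M) hk hk hs hv ht hτ MeasurableSet.univ C
  rw [univ_inter] at h
  have h2 := congrArg ENNReal.toReal h
  rw [ENNReal.toReal_mul] at h2
  refine le_of_eq_of_le h2.symm ?_
  exact measureReal_mono inter_subset_right

theorem mul_p_le (hk : k ∈ S) {s : ℤ} (hs : s ∈ S) {t v : ℝ} (ht : 0 ≤ t) (hv : 0 ≤ v) :
    M.p k k v * M.p k s t ≤ M.p k s (v + t) := by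
  simpa [flux_univ] using mul_flux_le (M := M) hk hs univ ht le_rfl hv

/-- Condition on the state at time `v`, not `t`: a chain found at `k` restarts afresh, and the error
is at most the probability of being elsewhere. The bound depends on neither `t` nor `s`, which gives
uniform continuity. -/
theorem abs_p_add_sub_le (hk : k ∈ S) {s : ℤ} (hs : s ∈ S) {t v : ℝ} (ht : 0 ≤ t) (hv : 0 ≤ v) :
    |M.p k s (t + v) - M.p k s t| ≤ 1 - M.p k k v := by
  have := M.isProbabilityMeasure k hk
  have h1 := mul_p_le (M := M) hk hs ht hv
  have h2 := flux_compl_singleton (M := M) hk (m := k) hs hv ht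
  have h3 : M.flux k {k}ᶜ s v t ≤ 1 - M.p k k v := by
    refine (measureReal_mono (s₂ := {ω | M.X v ω = k}ᶜ) fun ω hω => hω.1).trans_eq ?_
    have hm : MeasurableSet {ω | M.X v ω = k} := M.measurableSet_X hv {k}
    rw [measureReal_compl hm, probReal_univ]
    rfl
  rw [add_comm t v]
  have h4 := p_le_one (M := M) hk s t
  have h5 := p_le_one (M := M) hk k v
  have h6 := p_nonneg (M := M) (k := k) s t
  rw [abs_le]
  constructor <;> nlinarith

end MarkovChain

/-! ### Scheffé's lemma and the backward equation -/

/-- Scheffé's lemma for series: termwise convergence of nonnegative terms together with convergence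
of the sums implies convergence of the sums with bounded weights. -/
theorem tendsto_tsum_mul_of_hasSum {T ι : Type*} {l : Filter T} {a : T → ι → ℝ} {b : ι → ℝ}
    {σ : T → ℝ} {c : ℝ} (ha : ∀ᶠ t in l, ∀ i, 0 ≤ a t i) (hb : ∀ i, 0 ≤ b i)
    (has : ∀ᶠ t in l, HasSum (a t) (σ t)) (hbs : HasSum b c)
    (hab : ∀ i, Tendsto (fun t => a t i) l (𝓝 (b i))) (hσ : Tendsto σ l (𝓝 c))
    {w : ι → ℝ} (hw : ∀ i, |w i| ≤ 1) :
    Tendsto (fun t => ∑' i, a t i * w i) l (𝓝 (∑' i, b i * w i)) := by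
  have hpos : Tendsto (fun t => ∑' i, max (b i - a t i) 0) l (𝓝 0) := by
    have h := tendsto_tsum_of_dominated_convergence (𝓕 := l)
      (f := fun t i => max (b i - a t i) 0) (g := fun _ => (0 : ℝ)) hbs.summable
      (fun i => by
        simpa using (((hab i).const_sub (b i)).max (tendsto_const_nhds (x := (0 : ℝ)))))
      (ha.mono fun t ht i => by
        rw [Real.norm_eq_abs, abs_of_nonneg (le_max_right _ _)]
        exact max_le (by linarith [ht i]) (hb i))
    simpa using h
  -- From |a − b| = (a − b) + 2 (b − a)⁺, this expression is the ℓ¹ distance of `a t` and `b`. Only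
  -- the deficit (b − a)⁺ needs domination, and `b` dominates it.
  have hlim : Tendsto (fun t => σ t - c + 2 * ∑' i, max (b i - a t i) 0) l (𝓝 0) := by
    simpa using (hσ.sub_const c).add (hpos.const_mul 2)
  rw [tendsto_iff_norm_sub_tendsto_zero]
  refine squeeze_zero' (Eventually.of_forall fun t => norm_nonneg _) ?_ hlim
  filter_upwards [ha, has] with t hat hst
  have hm : ∀ {f : ι → ℝ}, (∀ i, 0 ≤ f i) → Summable f → Summable fun i => f i * w i := by
    intro f hf hs
    refine Summable.of_norm_bounded hs fun i => ?_
    rw [norm_mul, Real.norm_of_nonneg (hf i)]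
    exact mul_le_of_le_one_right (hf i) (hw i)
  have hps : Summable fun i => max (b i - a t i) 0 := by
    refine Summable.of_nonneg_of_le (fun i => le_max_right _ _) (fun i => ?_) hbs.summable
    exact max_le (by linarith [hat i]) (hb i)
  have hd := (hst.sub hbs).add (hps.hasSum.mul_left 2)
  rw [← (hm hat hst.summable).tsum_sub (hm hb hbs.summable)]
  refine tsum_of_norm_bounded hd fun i => ?_
  rw [← sub_mul, norm_mul]
  refine (mul_le_of_le_one_right (norm_nonneg _) (hw i)).trans ?_
  rw [Real.norm_eq_abs]
  rcases le_total (b i) (a t i) with h | h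
  · rw [abs_of_nonneg (by linarith), max_eq_right (by linarith)]
    linarith
  · rw [abs_of_nonpos (by linarith), max_eq_left (by linarith)]
    linarith

namespace MarkovChain

variable {Ω : Type*} [MeasurableSpace Ω] {S : Set ℤ} {M : MarkovChain Ω S} {k : ℤ}

theorem q_eq_zero (hk : k ∈ S) {n : ℤ} (hn : n ∉ S) : M.q k n = 0 := by
  have h : M.q k n = derivWithin (fun _ => (0 : ℝ)) (Ici (0 : ℝ)) (0 : ℝ) :=
    derivWithin_congr (fun t ht => p_eq_zero hk hn ht) (p_eq_zero hk hn le_rfl)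
  rw [h, derivWithin_fun_const]
  rfl

namespace HasGenerator

variable (hQ : M.HasGenerator)
include hQ

theorem hasDerivWithinAt_p (hk : k ∈ S) (n : ℤ) :
    HasDerivWithinAt (M.p k n) (M.q k n) (Ici 0) 0 := by
  by_cases hn : n ∈ S
  · exact (hQ.differentiable k hk n hn).hasDerivWithinAt
  · rw [q_eq_zero hk hn]
    exact (hasDerivWithinAt_const (0 : ℝ) (Ici 0) (0 : ℝ)).congr
      (fun t ht => p_eq_zero hk hn ht) (p_eq_zero hk hn le_rfl)

theorem hasSum_q (hk : k ∈ S) : HasSum (M.q k) 0 := by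
  refine (hasSum_subtype_iff_of_support_subset ?_).1 (hQ.row_sum k hk)
  intro n hn
  by_contra h
  exact hn (q_eq_zero hk h)

theorem q_nonneg (hk : k ∈ S) {n : ℤ} (hn : n ≠ k) : 0 ≤ M.q k n := by
  by_cases h : n ∈ S
  · exact hQ.offDiag_nonneg k hk n h hn.symm
  · exact (q_eq_zero hk h).ge

theorem tendsto_p_div (hk : k ∈ S) {n : ℤ} (hn : n ≠ k) :
    Tendsto (fun τ => M.p k n τ / τ) (𝓝[>] 0) (𝓝 (M.q k n)) := by
  have h := (hQ.hasDerivWithinAt_p hk n).mono Ioi_subset_Ici_self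
  rw [hasDerivWithinAt_iff_tendsto_slope' (by simp)] at h
  refine h.congr fun τ => ?_
  rw [slope_def_field, p_zero_of_ne hk hn, sub_zero, sub_zero]

theorem tendsto_one_sub_p_div (hk : k ∈ S) :
    Tendsto (fun τ => (1 - M.p k k τ) / τ) (𝓝[>] 0) (𝓝 (-M.q k k)) := by
  have h := (hQ.hasDerivWithinAt_p hk k).mono Ioi_subset_Ici_self
  rw [hasDerivWithinAt_iff_tendsto_slope' (by simp)] at h
  refine h.neg.congr fun τ => ?_
  rw [slope_def_field, p_zero_self hk, sub_zero, ← neg_div, neg_sub]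

theorem tendsto_p_self (hk : k ∈ S) : Tendsto (M.p k k) (𝓝[≥] 0) (𝓝 1) := by
  have h := (hQ.hasDerivWithinAt_p hk k).continuousWithinAt
  rwa [ContinuousWithinAt, p_zero_self hk] at h

theorem continuousOn_p (hk : k ∈ S) {n : ℤ} (hn : n ∈ S) : ContinuousOn (M.p k n) (Ici 0) := by
  intro t ht
  have hle : ∀ u ∈ Ici (0 : ℝ), ‖M.p k n u - M.p k n t‖ ≤ 1 - M.p k k |u - t| := by
    intro u hu
    rcases le_total t u with h | h
    · rw [abs_of_nonneg (sub_nonneg.2 h)]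
      simpa using abs_p_add_sub_le (M := M) hk hn ht (sub_nonneg.2 h)
    · rw [abs_of_nonpos (sub_nonpos.2 h), neg_sub, norm_sub_rev]
      simpa using abs_p_add_sub_le (M := M) hk hn hu (sub_nonneg.2 h)
  have h1 : Tendsto (fun u => |u - t|) (𝓝[Ici 0] t) (𝓝[≥] 0) := by
    refine tendsto_nhdsWithin_iff.2 ⟨?_, Eventually.of_forall fun u => abs_nonneg (u - t)⟩
    have h : Continuous fun u : ℝ => |u - t| := by fun_prop
    simpa using (h.tendsto t).mono_left nhdsWithin_le_nhds
  have h2 := ((hQ.tendsto_p_self hk).comp h1).const_sub 1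
  rw [sub_self] at h2
  rw [ContinuousWithinAt, tendsto_iff_norm_sub_tendsto_zero]
  exact squeeze_zero' (Eventually.of_forall fun u => norm_nonneg _)
    (eventually_mem_nhdsWithin.mono hle) h2

end HasGenerator

variable (M) in
/-- The total probability current into `s`, in backward form. -/
noncomputable def inflow (k s : ℤ) (t : ℝ) : ℝ :=
  ∑' l, M.q k l * M.p l s t - M.p k s t * M.q s s

theorem norm_q_mul_p_le (hk : k ∈ S) (s l : ℤ) (t : ℝ) : ‖M.q k l * M.p l s t‖ ≤ ‖M.q k l‖ := by
  by_cases hl : l ∈ S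
  · rw [norm_mul, Real.norm_of_nonneg (p_nonneg (M := M) (k := l) s t)]
    exact mul_le_of_le_one_right (norm_nonneg _) (p_le_one hl s t)
  · simp [q_eq_zero hk hl]

namespace HasGenerator

variable (hQ : M.HasGenerator)
include hQ

theorem continuousOn_inflow (hk : k ∈ S) {s : ℤ} (hs : s ∈ S) :
    ContinuousOn (M.inflow k s) (Ici 0) := by
  refine ContinuousOn.sub (continuousOn_tsum (u := fun l => ‖M.q k l‖) (fun l => ?_)
    (hQ.hasSum_q hk).summable.norm fun l t _ => norm_q_mul_p_le hk s l t)
    ((hQ.continuousOn_p hk hs).mul_const _)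
  by_cases hl : l ∈ S
  · exact continuousOn_const.mul (hQ.continuousOn_p hl hs)
  · simp only [q_eq_zero hk hl, zero_mul]
    exact continuousOn_const

/-- The backward equation: the right derivative of the transition probabilities. -/
theorem tendsto_p_slope (hk : k ∈ S) {s : ℤ} (hs : s ∈ S) {t : ℝ} (ht : 0 ≤ t) :
    Tendsto (fun τ => (M.p k s (t + τ) - M.p k s t) / τ) (𝓝[>] 0)
      (𝓝 (∑' l, M.q k l * M.p l s t)) := by
  have hoff : ∀ {f : ℤ → ℝ} {c : ℝ}, HasSum f c →
      HasSum (fun l => if l = k then 0 else f l) (c - f k) := by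
    intro f c hf
    have e : (fun l => if l = k then 0 else f l) = fun l => f l - if l = k then f k else 0 := by
      funext l
      by_cases h : l = k
      · subst h; simp
      · simp [h]
    rw [e]
    exact hf.sub (hasSum_ite_eq k (f k))
  have hpos : ∀ᶠ τ : ℝ in 𝓝[>] 0, 0 < τ := eventually_mem_nhdsWithin
  -- Conservativeness is what Scheffé requires: the off-diagonal quotients sum to (1 −
  -- p_{k,k}(τ))/τ, whose limit −q_{k,k} is the sum of the off-diagonal rates. The weight is cut off
  -- to `S` because `M.P l` is unconstrained for `l ∉ S`.
  have hsch := tendsto_tsum_mul_of_hasSum (l := 𝓝[>] (0 : ℝ))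
    (a := fun τ l => if l = k then 0 else M.p k l τ / τ)
    (b := fun l => if l = k then 0 else M.q k l)
    (σ := fun τ => (1 - M.p k k τ) / τ) (c := -M.q k k)
    (w := S.indicator fun l => M.p l s t)
    (hpos.mono fun τ hτ l => by
      split_ifs
      · exact le_rfl
      · exact div_nonneg (p_nonneg l τ) hτ.le)
    (fun l => by
      split_ifs with h
      · exact le_rfl
      · exact hQ.q_nonneg hk h)
    (hpos.mono fun τ hτ => by
      rw [sub_div]
      exact hoff ((hasSum_p hk hτ.le).div_const τ))
    (by simpa using hoff (hQ.hasSum_q hk))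
    (fun l => by
      split_ifs with h
      · exact tendsto_const_nhds
      · exact hQ.tendsto_p_div hk h)
    (hQ.tendsto_one_sub_p_div hk)
    (fun l => by
      by_cases hl : l ∈ S
      · rw [indicator_of_mem hl, abs_of_nonneg (p_nonneg s t)]
        exact p_le_one hl s t
      · simp [hl])
  have hself := (hQ.tendsto_one_sub_p_div hk).mul_const (M.p k s t)
  have hlim := hsch.sub hself
  have e0 : ∑' l, (if l = k then 0 else M.q k l) * S.indicator (fun l => M.p l s t) l =
      ∑' l, M.q k l * M.p l s t - M.q k k * M.p k s t := by
    have hsum : Summable fun l => M.q k l * M.p l s t :=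
      Summable.of_norm_bounded (hQ.hasSum_q hk).summable.norm
        fun l => norm_q_mul_p_le hk s l t
    rw [← (hoff hsum.hasSum).tsum_eq]
    refine tsum_congr fun l => ?_
    by_cases hl : l ∈ S
    · rw [indicator_of_mem hl, ite_mul, zero_mul]
    · simp [hl, q_eq_zero hk hl]
  rw [e0] at hlim
  simp only [neg_mul, sub_neg_eq_add, sub_add_cancel] at hlim
  refine hlim.congr' (hpos.mono fun τ hτ => ?_)
  have h1 := (hoff (hasSum_p_add (M := M) hk hs hτ.le ht)).div_const τ
  have e1 : ∑' l, (if l = k then 0 else M.p k l τ / τ) * S.indicator (fun l => M.p l s t) l =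
      (M.p k s (τ + t) - M.p k k τ * M.p k s t) / τ := by
    rw [← h1.tsum_eq]
    refine tsum_congr fun l => ?_
    by_cases hlk : l = k
    · simp [hlk]
    by_cases hl : l ∈ S
    · rw [indicator_of_mem hl, if_neg hlk, if_neg hlk]
      ring
    · simp [hl, p_eq_zero hk hl hτ.le]
  rw [e1, add_comm τ t]
  field_simp
  ring

/-- The flux from {s}ᶜ is the increment of p_{k,s} plus the loss p_{k,s}(t)(1 − p_{s,s}(τ)), so the
backward equation at `k` and the exit rate of `s` determine its limit. -/
theorem tendsto_flux_compl_div (hk : k ∈ S) {s : ℤ} (hs : s ∈ S) {t : ℝ} (ht : 0 ≤ t) :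
    Tendsto (fun τ => M.flux k {s}ᶜ s t τ / τ) (𝓝[>] 0) (𝓝 (M.inflow k s t)) := by
  have h := (hQ.tendsto_p_slope hk hs ht).add
    ((hQ.tendsto_one_sub_p_div hs).const_mul (M.p k s t))
  rw [mul_neg, ← sub_eq_add_neg] at h
  refine h.congr' (eventually_mem_nhdsWithin.mono fun τ (hτ : 0 < τ) => ?_)
  simp only [flux_compl_singleton hk hs ht hτ.le]
  ring

end HasGenerator

end MarkovChain

/-! ### Dyadic entry counts and the forward equation -/

/-- A step path visits finitely many states in a bounded time interval. -/
theorem IsStepPath.exists_bound {w : ℝ → ℤ} (hw : IsStepPath w) (T : ℝ) :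
    ∃ N : ℤ, ∀ u, 0 ≤ u → u ≤ T → |w u| ≤ N := by
  have h := isCompact_Icc (a := (0 : ℝ)) (b := T) |>.induction_on
    (p := fun A => ∃ N : ℤ, ∀ u ∈ A, 0 ≤ u → |w u| ≤ N) ⟨0, by simp⟩
    (fun A B hAB ⟨N, hN⟩ => ⟨N, fun u hu => hN u (hAB hu)⟩)
    (fun A B ⟨N, hN⟩ ⟨N', hN'⟩ => ⟨max N N', fun u hu h0 => hu.elim
      (fun h => (hN u h h0).trans (le_max_left _ _))
      (fun h => (hN' u h h0).trans (le_max_right _ _))⟩) ?_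
  · obtain ⟨N, hN⟩ := h
    exact ⟨N, fun u h0 hT => hN u ⟨h0, hT⟩ h0⟩
  intro x hx
  have hr := hw.1 x hx.1
  have hl : ∃ n : ℤ, ∀ᶠ u in 𝓝[<] x, 0 ≤ u → w u = n := by
    rcases hx.1.eq_or_lt with h | h
    · refine ⟨0, eventually_mem_nhdsWithin.mono fun u (hu : u < x) h0 => ?_⟩
      exact absurd h0 (not_le.2 (h ▸ hu))
    · obtain ⟨n, hn⟩ := hw.2 x h
      exact ⟨n, hn.mono fun u hu _ => hu⟩
  obtain ⟨n, hn⟩ := hl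
  have hx' : ∀ᶠ u in 𝓝 x, 0 ≤ u → |w u| ≤ max |w x| |n| := by
    rw [← nhdsLT_sup_nhdsGE, ← nhdsGT_sup_nhdsWithin_singleton x]
    simp only [nhdsWithin_singleton, eventually_sup]
    refine ⟨hn.mono fun u hu h0 => ?_, hr.mono fun u hu _ => ?_, ?_⟩
    · rw [hu h0]
      exact le_max_right _ _
    · rw [hu]
      exact le_max_left _ _
    · simp
  exact ⟨_, mem_nhdsWithin_of_mem_nhds hx', _, fun u hu => hu⟩

theorem tendsto_div_two_pow {ε : ℝ} (hε : 0 < ε) :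
    Tendsto (fun m : ℕ => ε / 2 ^ m) atTop (𝓝[>] 0) := by
  refine tendsto_nhdsWithin_iff.2 ⟨?_, Eventually.of_forall fun m => ?_⟩
  · exact tendsto_const_nhds.div_atTop (tendsto_pow_atTop_atTop_of_one_lt one_lt_two)
  · exact div_pos hε (pow_pos two_pos m)

/-- The number of steps, on a grid of mesh `δ` with `n` steps, that lead from `C` to `s`. -/
noncomputable def entryCount (w : ℝ → ℤ) (C : Set ℤ) (s : ℤ) (t δ : ℝ) (n : ℕ) : ENNReal :=
  ∑ l ∈ Finset.range n, {v | w v ∈ C ∧ w (v + δ) = s}.indicator 1 (t + l * δ)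

theorem entryCount_mono (w : ℝ → ℤ) {C C' : Set ℤ} (h : C ⊆ C') (s : ℤ) (t δ : ℝ) (n : ℕ) :
    entryCount w C s t δ n ≤ entryCount w C' s t δ n :=
  Finset.sum_le_sum fun _ _ => indicator_le_indicator_of_subset
    (s := {v | w v ∈ C ∧ w (v + δ) = s}) (t := {v | w v ∈ C' ∧ w (v + δ) = s})
    (fun _ hv => ⟨h hv.1, hv.2⟩) (fun _ => zero_le) _

/-- Halving the mesh does not decrease the number of entries into `s`. -/
theorem entryCount_le_half (w : ℝ → ℤ) (s : ℤ) (t δ : ℝ) (n : ℕ) :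
    entryCount w {s}ᶜ s t δ n ≤ entryCount w {s}ᶜ s t (δ / 2) (2 * n) := by
  induction n with
  | zero => simp [entryCount]
  | succ n ih =>
    have e : 2 * (n + 1) = 2 * n + 1 + 1 := by ring
    unfold entryCount at ih ⊢
    rw [e, Finset.sum_range_succ, Finset.sum_range_succ, Finset.sum_range_succ, add_assoc]
    refine add_le_add ih ?_
    have e1 : t + ((2 * n : ℕ) : ℝ) * (δ / 2) = t + n * δ := by push_cast; ring
    have e2 : t + ((2 * n + 1 : ℕ) : ℝ) * (δ / 2) = t + n * δ + δ / 2 := by push_cast; ring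
    rw [e1, e2]
    have e3 : t + n * δ + δ / 2 + δ / 2 = t + n * δ + δ := by ring
    -- If the coarse step enters `s`, look at the midpoint: at `s`, the first half-step is an entry;
    -- elsewhere, the second one is.
    simp only [indicator, mem_ofPred_eq, mem_compl_iff, mem_singleton_iff, e3]
    split_ifs <;> simp_all

namespace MarkovChain

variable {Ω : Type*} [MeasurableSpace Ω] {S : Set ℤ} {M : MarkovChain Ω S} {k : ℤ}

theorem measurable_entryCount (C : Set ℤ) (s : ℤ) {t δ : ℝ} (ht : 0 ≤ t) (hδ : 0 ≤ δ) (n : ℕ) :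
    Measurable fun ω => entryCount (fun t => M.X t ω) C s t δ n := by
  refine Finset.measurable_sum _ fun l _ => ?_
  exact measurable_one.indicator (M.measurableSet_flux C s (by positivity : 0 ≤ t + l * δ) hδ)

theorem lintegral_entryCount (hk : k ∈ S) (C : Set ℤ) (s : ℤ) {t δ : ℝ} (ht : 0 ≤ t)
    (hδ : 0 ≤ δ) (n : ℕ) :
    ∫⁻ ω, entryCount (fun t => M.X t ω) C s t δ n ∂(M.P k) =
      ENNReal.ofReal (∑ l ∈ Finset.range n, M.flux k C s (t + l * δ) δ) := by
  have := M.isProbabilityMeasure k hk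
  have hm := fun l : ℕ => M.measurableSet_flux C s (by positivity : 0 ≤ t + l * δ) hδ
  rw [ENNReal.ofReal_sum_of_nonneg fun l _ => flux_nonneg C s _ _]
  unfold entryCount
  rw [lintegral_finsetSum]
  · refine Finset.sum_congr rfl fun l _ => ?_
    rw [flux, ofReal_measureReal]
    exact lintegral_indicator_one (hm l)
  · exact fun l _ => measurable_one.indicator (hm l)

namespace HasGenerator

/-- Each flux is at most an increment of p_{k,s} plus 1 − p_{s,s}(δ). The increments telescope to at
most 1, and the 2^m losses are each O(δ) with 2^m δ = ε. Thus the expected number of grid entries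
into `s` is bounded independently of the mesh. -/
theorem exists_sum_flux_le (hQ : M.HasGenerator) (hk : k ∈ S) {s : ℤ} (hs : s ∈ S) {t ε : ℝ}
    (ht : 0 ≤ t) (hε : 0 < ε) :
    ∃ K : ℝ, ∀ m : ℕ,
      ∑ l ∈ Finset.range (2 ^ m), M.flux k {s}ᶜ s (t + l * (ε / 2 ^ m)) (ε / 2 ^ m) ≤ K := by
  have h := ((hQ.tendsto_one_sub_p_div hs).comp (tendsto_div_two_pow hε)).bddAbove_range
  obtain ⟨K, hK⟩ := h
  refine ⟨1 + ε * K, fun m => ?_⟩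
  have h1 : (1 - M.p s s (ε / 2 ^ m)) / (ε / 2 ^ m) ≤ K := hK ⟨m, rfl⟩
  set δ := ε / 2 ^ m with hδ
  have hδ0 : 0 < δ := div_pos hε (pow_pos two_pos m)
  have h2 : ∀ n : ℕ, ∑ l ∈ Finset.range n, M.flux k {s}ᶜ s (t + l * δ) δ ≤
      M.p k s (t + n * δ) - M.p k s t + n * (1 - M.p s s δ) := by
    intro n
    induction n with
    | zero => simp
    | succ n ih =>
      rw [Finset.sum_range_succ, flux_compl_singleton hk hs (by positivity) hδ0.le]
      have e : t + n * δ + δ = t + (n + 1 : ℕ) * δ := by push_cast; ring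
      rw [e]
      push_cast
      have := p_le_one (M := M) hk s (t + n * δ)
      have := p_le_one (M := M) hs s δ
      nlinarith
  refine (h2 _).trans ?_
  have h3 := p_le_one (M := M) hk s (t + (2 ^ m : ℕ) * δ)
  have h4 := p_nonneg (M := M) (k := k) s t
  rw [div_le_iff₀ hδ0] at h1
  have h5 : ((2 ^ m : ℕ) : ℝ) * (1 - M.p s s δ) ≤ (2 ^ m : ℕ) * (K * δ) := by gcongr
  have h6 : ((2 ^ m : ℕ) : ℝ) * (K * δ) = ε * K := by
    rw [hδ]
    push_cast
    field_simp
  linarith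

/-- Entries into `s` from remote states are rare, uniformly over dyadic grids. -/
theorem exists_sum_flux_remote_le (hQ : M.HasGenerator) (hk : k ∈ S) {s : ℤ} (hs : s ∈ S)
    {t ε : ℝ} (ht : 0 ≤ t) (hε : 0 < ε) :
    ∃ e : ℕ → ℝ, Tendsto e atTop (𝓝 0) ∧ ∀ j m : ℕ,
      ∑ l ∈ Finset.range (2 ^ m),
        M.flux k (insert s (Icc (-j : ℤ) j))ᶜ s (t + l * (ε / 2 ^ m)) (ε / 2 ^ m) ≤ e j := by
  have := M.isProbabilityMeasure k hk
  obtain ⟨K, hK⟩ := hQ.exists_sum_flux_le hk hs ht hε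
  have hδ : ∀ m : ℕ, 0 ≤ ε / 2 ^ m := fun m => by positivity
  set N : ℕ → Ω → ENNReal := fun m ω =>
    entryCount (fun t => M.X t ω) {s}ᶜ s t (ε / 2 ^ m) (2 ^ m) with hN
  set Y : ℕ → Ω → ENNReal := fun j ω =>
    ⨆ m : ℕ, entryCount (fun t => M.X t ω) (insert s (Icc (-j : ℤ) j))ᶜ s t (ε / 2 ^ m) (2 ^ m)
    with hY
  have hYN : ∀ j ω, Y j ω ≤ ⨆ m, N m ω := fun j ω => iSup_mono fun m =>
    entryCount_mono _ (compl_subset_compl.2 (by simp)) s t _ _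
  have hNm : Monotone N := by
    refine monotone_nat_of_le_succ fun m ω => ?_
    refine (entryCount_le_half _ s t (ε / 2 ^ m) (2 ^ m)).trans_eq ?_
    rw [hN]
    simp only
    rw [pow_succ' (2 : ℕ) m, pow_succ (2 : ℝ) m, div_mul_eq_div_div]
  have hfin : ∫⁻ ω, ⨆ m, N m ω ∂(M.P k) ≠ ⊤ := by
    rw [lintegral_iSup (fun m => measurable_entryCount _ _ ht (hδ m) _) hNm]
    refine ne_top_of_le_ne_top ENNReal.ofReal_ne_top
      (iSup_le (a := ENNReal.ofReal K) fun m => ?_)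
    rw [lintegral_entryCount hk _ _ ht (hδ m)]
    exact ENNReal.ofReal_le_ofReal (hK m)
  have hYmeas : ∀ j, Measurable (Y j) := fun j =>
    Measurable.iSup fun m => measurable_entryCount _ _ ht (hδ m) _
  have hYfin : ∀ j, ∫⁻ ω, Y j ω ∂(M.P k) ≠ ⊤ := fun j =>
    ne_top_of_le_ne_top hfin (lintegral_mono (hYN j))
  -- Dominated convergence: the supremum of all entry counts is integrable by monotone convergence,
  -- and on a path bounded by `B` up to time `t + ε` no entry is remote once `j ≥ B`.
  have hlim : Tendsto (fun j => ∫⁻ ω, Y j ω ∂(M.P k)) atTop (𝓝 0) := by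
    have h := tendsto_lintegral_of_dominated_convergence (μ := M.P k) (f := fun _ => 0)
      (fun ω => ⨆ m, N m ω) hYmeas (fun j => ae_of_all _ (hYN j)) hfin ?_
    · simpa using h
    filter_upwards [M.step_path k hk] with ω hω
    obtain ⟨B, hB⟩ := hω.exists_bound (t + ε)
    refine tendsto_const_nhds.congr' ?_
    filter_upwards [eventually_ge_atTop B.toNat] with j hj
    refine (ENNReal.iSup_eq_zero.2 fun m => Finset.sum_eq_zero fun l hl => ?_).symm
    refine indicator_of_notMem (fun hv => hv.1 (mem_insert_of_mem _ ?_)) _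
    have hl' : ((l : ℕ) : ℝ) ≤ 2 ^ m := by exact_mod_cast (Finset.mem_range.1 hl).le
    have hle : (l : ℝ) * (ε / 2 ^ m) ≤ ε := by
      rw [mul_div_assoc', div_le_iff₀ (by positivity), mul_comm]
      gcongr
    have := hB (t + l * (ε / 2 ^ m)) (by have := hδ m; positivity) (by linarith)
    rw [abs_le] at this
    exact ⟨by simp only; omega, by simp only; omega⟩
  refine ⟨fun j => (∫⁻ ω, Y j ω ∂(M.P k)).toReal, ?_, fun j m => ?_⟩
  · exact (ENNReal.tendsto_toReal ENNReal.zero_ne_top).comp hlim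
  · rw [← ENNReal.ofReal_le_iff_le_toReal (hYfin j), ← lintegral_entryCount hk _ _ ht (hδ m)]
    exact lintegral_mono fun ω => le_iSup (fun m => entryCount (fun t => M.X t ω)
      (insert s (Icc (-j : ℤ) j))ᶜ s t (ε / 2 ^ m) (2 ^ m)) m

theorem tendsto_p_mul_p_div (hQ : M.HasGenerator) (hk : k ∈ S) {s : ℤ} {t : ℝ}
    (ht : 0 ≤ t) (C : Set ℤ) (hC : s ∉ C) (i : ℤ) :
    Tendsto (fun τ => C.indicator (fun i => M.p k i t * M.p i s τ) i / τ) (𝓝[>] 0)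
      (𝓝 (C.indicator (fun i => M.p k i t * M.q i s) i)) := by
  by_cases hi : i ∈ C
  · simp only [indicator_of_mem hi]
    by_cases hiS : i ∈ S
    · simp only [mul_div_assoc]
      exact (hQ.tendsto_p_div (n := s) hiS (by rintro rfl; exact hC hi)).const_mul _
    · simp [p_eq_zero hk hiS ht]
  · simp [hi]

theorem current_nonneg (hQ : M.HasGenerator) (hk : k ∈ S) {s : ℤ} {t : ℝ}
    (ht : 0 ≤ t) (C : Set ℤ) (hC : s ∉ C) (i : ℤ) :
    0 ≤ C.indicator (fun i => M.p k i t * M.q i s) i := by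
  by_cases hi : i ∈ C
  · rw [indicator_of_mem hi]
    by_cases hiS : i ∈ S
    · exact mul_nonneg (p_nonneg i t) (hQ.q_nonneg hiS fun h => hC (by rwa [h]))
    · simp [p_eq_zero hk hiS ht]
  · simp [hi]

/-- The forward equation: the total current into `s` is the sum of the currents from all other
states. -/
theorem hasSum_inflow (hQ : M.HasGenerator) (hk : k ∈ S) {s : ℤ} (hs : s ∈ S) {t : ℝ}
    (ht : 0 ≤ t) :
    HasSum (({s}ᶜ : Set ℤ).indicator fun i => M.p k i t * M.q i s) (M.inflow k s t) := by
  have hsC : s ∉ ({s}ᶜ : Set ℤ) := by simp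
  have hnn := hQ.current_nonneg hk ht {s}ᶜ hsC
  have hterm : ∀ F : Finset ℤ, Tendsto
      (fun τ => ∑ i ∈ F, ({s}ᶜ : Set ℤ).indicator (fun i => M.p k i t * M.p i s τ) i / τ)
      (𝓝[>] 0) (𝓝 (∑ i ∈ F, ({s}ᶜ : Set ℤ).indicator (fun i => M.p k i t * M.q i s) i)) :=
    fun F => tendsto_finsetSum F fun i _ => hQ.tendsto_p_mul_p_div hk ht {s}ᶜ hsC i
  have hle : ∀ F : Finset ℤ, ∑ i ∈ F, ({s}ᶜ : Set ℤ).indicator (fun i => M.p k i t * M.q i s) i ≤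
      M.inflow k s t := by
    -- The Fatou half: a finite partial sum of the flux never exceeds the whole.
    refine fun F => le_of_tendsto_of_tendsto (hterm F) (hQ.tendsto_flux_compl_div hk hs ht) ?_
    filter_upwards [eventually_mem_nhdsWithin] with τ (hτ : 0 < τ)
    rw [← Finset.sum_div]
    gcongr
    exact sum_le_hasSum F (fun i _ => indicator_nonneg
      (fun i _ => mul_nonneg (p_nonneg i t) (p_nonneg s τ)) i) (hasSum_flux hk hs _ ht hτ.le)
  have hsum := summable_of_sum_le hnn hle
  refine (hsum.hasSum_iff).2 (le_antisymm (hsum.tsum_le_of_sum_le hle) ?_)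
  obtain ⟨ε, hε, hεp⟩ : ∃ ε : ℝ, 0 < ε ∧ ∀ v, 0 ≤ v → v ≤ ε → 1 / 2 ≤ M.p k k v := by
    have h := (hQ.tendsto_p_self hk).eventually_const_le (by norm_num : (1 / 2 : ℝ) < 1)
    obtain ⟨ε, hε, h⟩ := mem_nhdsGE_iff_exists_Icc_subset.1 h
    exact ⟨ε, hε, fun v h0 h1 => h ⟨h0, h1⟩⟩
  obtain ⟨e, he, hb⟩ := hQ.exists_sum_flux_remote_le hk hs ht hε
  set h := ∑' i, ({s}ᶜ : Set ℤ).indicator (fun i => M.p k i t * M.q i s) i with hh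
  -- The tightness half: states in [−j, j] contribute at most `h` in the limit, and the rest at most
  -- 2 e_j/ε for every mesh.
  have hbound : ∀ j, M.inflow k s t ≤ h + 2 * e j / ε := by
    intro j
    refine le_trans ?_ (add_le_add_left (hsum.sum_le_tsum (Finset.Icc (-j : ℤ) j)
      fun i _ => hnn i) _)
    refine le_of_tendsto_of_tendsto
      ((hQ.tendsto_flux_compl_div hk hs ht).comp (tendsto_div_two_pow hε))
      (((hterm _).comp (tendsto_div_two_pow hε)).add_const _) (Eventually.of_forall fun m => ?_)
    simp only [Function.comp_apply]
    have hbm := hb j m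
    set δ := ε / 2 ^ m with hδ
    have hδ0 : 0 < δ := div_pos hε (pow_pos two_pos m)
    have hsplit : M.flux k {s}ᶜ s t δ =
        ∑ i ∈ Finset.Icc (-j : ℤ) j, ({s}ᶜ : Set ℤ).indicator (fun i => M.p k i t * M.p i s δ) i +
          M.flux k (insert s (Icc (-j : ℤ) j))ᶜ s t δ := by
      have h1 := (hasSum_flux (M := M) hk hs {s}ᶜ ht hδ0.le).sub
        (hasSum_flux (M := M) hk hs (insert s (Icc (-j : ℤ) j))ᶜ ht hδ0.le)
      have h2 := hasSum_sum_of_ne_finset_zero (L := .unconditional ℤ) (s := Finset.Icc (-j : ℤ) j)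
        (f := fun i => ({s}ᶜ : Set ℤ).indicator (fun i => M.p k i t * M.p i s δ) i -
          (insert s (Icc (-j : ℤ) j))ᶜ.indicator (fun i => M.p k i t * M.p i s δ) i) ?_
      · rw [← sub_eq_iff_eq_add, h1.unique h2]
        refine Finset.sum_congr rfl fun i hi => ?_
        rw [indicator_of_notMem (s := (insert s (Icc (-j : ℤ) j))ᶜ), sub_zero]
        simpa using fun _ => Finset.mem_Icc.1 hi
      · intro i hi
        rw [Finset.mem_Icc] at hi
        by_cases his : i = s
        · simp [his]
        · rw [indicator_of_mem (by simpa using his), indicator_of_mem, sub_self]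
          simp only [mem_compl_iff, mem_insert_iff, mem_Icc]
          tauto
    -- Waiting at `k` for time lδ ≤ ε costs a factor at most 2, so the remote flux at each grid time
    -- t + lδ is at least half that at `t`. Summation over the 2^m grid times turns a bound on the
    -- sum into one at the single time `t`.
    have hremote : 2 ^ m * (1 / 2 * M.flux k (insert s (Icc (-j : ℤ) j))ᶜ s t δ) ≤ e j := by
      have hc := Finset.card_nsmul_le_sum (Finset.range (2 ^ m))
        (fun l : ℕ => M.flux k (insert s (Icc (-j : ℤ) j))ᶜ s (t + l * δ) δ)
        (1 / 2 * M.flux k (insert s (Icc (-j : ℤ) j))ᶜ s t δ) fun l hl => ?_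
      · rw [Finset.card_range, nsmul_eq_mul] at hc
        push_cast at hc
        exact hc.trans hbm
      have hl' : ((l : ℕ) : ℝ) ≤ 2 ^ m := by exact_mod_cast (Finset.mem_range.1 hl).le
      have hle : (l : ℝ) * δ ≤ ε := by
        rw [hδ, mul_div_assoc', div_le_iff₀ (by positivity), mul_comm]
        gcongr
      rw [add_comm t]
      refine le_trans ?_ (mul_flux_le hk hs _ ht hδ0.le (by positivity))
      exact mul_le_mul_of_nonneg_right (hεp _ (by positivity) hle) (flux_nonneg _ _ _ _)
    rw [hsplit, add_div, Finset.sum_div]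
    refine add_le_add_right ?_ _
    rw [div_le_div_iff₀ hδ0 hε]
    have hε' : (2 : ℝ) ^ m * δ = ε := by rw [hδ]; field_simp
    have := mul_le_mul_of_nonneg_right hremote hδ0.le
    rw [← hε']
    linarith
  refine ge_of_tendsto (x := atTop) (f := fun j => h + 2 * e j / ε) ?_
    (Eventually.of_forall hbound)
  simpa using ((he.const_mul 2).div_const ε).const_add h

end HasGenerator

end MarkovChain

/-! ### Currents from a set of states -/

namespace MarkovChain

variable {Ω : Type*} [MeasurableSpace Ω] {S : Set ℤ} {M : MarkovChain Ω S} {k : ℤ}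

variable (M) in
/-- The probability current from `C` into `s`. -/
noncomputable def current (k : ℤ) (C : Set ℤ) (s : ℤ) (t : ℝ) : ℝ :=
  ∑' i, C.indicator (fun i => M.p k i t * M.q i s) i

theorem indicator_compl_mul_indicator_one {s : ℤ} {C : Set ℤ} (hC : s ∉ C) (f : ℤ → ℝ) (i : ℤ) :
    ({s}ᶜ : Set ℤ).indicator f i * C.indicator 1 i = C.indicator f i := by
  by_cases hi : i ∈ C
  · have : i ≠ s := by rintro rfl; exact hC hi
    simp [hi, this]
  · simp [hi]

theorem abs_indicator_one_le (C : Set ℤ) (i : ℤ) : |C.indicator (1 : ℤ → ℝ) i| ≤ 1 := by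
  by_cases hi : i ∈ C <;> simp [hi]

namespace HasGenerator

theorem summable_current (hQ : M.HasGenerator) (hk : k ∈ S) {s : ℤ} (hs : s ∈ S) {C : Set ℤ}
    (hC : s ∉ C) {t : ℝ} (ht : 0 ≤ t) :
    Summable (C.indicator fun i => M.p k i t * M.q i s) := by
  have h := (hQ.hasSum_inflow hk hs ht).summable.indicator C
  rwa [indicator_indicator, inter_eq_left.2 fun i hi => by rintro rfl; exact hC hi] at h

/-- The flux quotients converge to the probability current. -/
theorem tendsto_flux_div (hQ : M.HasGenerator) (hk : k ∈ S) {s : ℤ} (hs : s ∈ S) {C : Set ℤ}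
    (hC : s ∉ C) {t : ℝ} (ht : 0 ≤ t) :
    Tendsto (fun τ => M.flux k C s t τ / τ) (𝓝[>] 0) (𝓝 (M.current k C s t)) := by
  have hsC : s ∉ ({s}ᶜ : Set ℤ) := by simp
  have hpos : ∀ᶠ τ : ℝ in 𝓝[>] 0, 0 < τ := eventually_mem_nhdsWithin
  -- The forward equation says that no mass is lost in the total flux; weighting Scheffé by the
  -- indicator of `C` then extracts the part from `C`.
  have h := tendsto_tsum_mul_of_hasSum (l := 𝓝[>] (0 : ℝ))
    (a := fun τ i => ({s}ᶜ : Set ℤ).indicator (fun i => M.p k i t * M.p i s τ) i / τ)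
    (hpos.mono fun τ hτ i => div_nonneg (indicator_nonneg
      (fun i _ => mul_nonneg (p_nonneg i t) (p_nonneg s τ)) i) hτ.le)
    (hQ.current_nonneg hk ht {s}ᶜ hsC)
    (hpos.mono fun τ hτ => (hasSum_flux hk hs _ ht hτ.le).div_const τ)
    (hQ.hasSum_inflow hk hs ht) (hQ.tendsto_p_mul_p_div hk ht {s}ᶜ hsC)
    (hQ.tendsto_flux_compl_div hk hs ht) (abs_indicator_one_le C)
  simp only [div_mul_eq_mul_div, indicator_compl_mul_indicator_one hC] at h
  refine h.congr' (hpos.mono fun τ hτ => ?_)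
  rw [tsum_div_const, (hasSum_flux hk hs C ht hτ.le).tsum_eq]

/-- Scheffé in the variable `t`: the terms are continuous, and so is their full sum, since by the
forward equation it equals `inflow`. -/
theorem continuousOn_current (hQ : M.HasGenerator) (hk : k ∈ S) {s : ℤ} (hs : s ∈ S) {C : Set ℤ}
    (hC : s ∉ C) : ContinuousOn (M.current k C s) (Ici 0) := by
  intro t ht
  have hsC : s ∉ ({s}ᶜ : Set ℤ) := by simp
  have h := tendsto_tsum_mul_of_hasSum (l := 𝓝[Ici 0] t)
    (a := fun t i => ({s}ᶜ : Set ℤ).indicator (fun i => M.p k i t * M.q i s) i)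
    (eventually_mem_nhdsWithin.mono fun u hu => hQ.current_nonneg hk hu {s}ᶜ hsC)
    (hQ.current_nonneg hk ht {s}ᶜ hsC)
    (eventually_mem_nhdsWithin.mono fun u hu => hQ.hasSum_inflow hk hs hu)
    (hQ.hasSum_inflow hk hs ht)
    (fun i => by
      by_cases his : i = s
      · simpa [his] using tendsto_const_nhds
      have hi : i ∈ ({s}ᶜ : Set ℤ) := his
      simp only [indicator_of_mem hi]
      by_cases hiS : i ∈ S
      · exact (hQ.continuousOn_p hk hiS t ht).mul_const _
      · rw [p_eq_zero hk hiS ht]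
        refine tendsto_const_nhds.congr' (eventually_mem_nhdsWithin.mono fun u hu => ?_)
        simp only [p_eq_zero hk hiS hu])
    (hQ.continuousOn_inflow hk hs t ht) (abs_indicator_one_le C)
  simp only [indicator_compl_mul_indicator_one hC] at h
  exact h

/-- The holding probability decreases at most linearly. -/
theorem exists_one_sub_mul_le (hQ : M.HasGenerator) (hk : k ∈ S) :
    ∃ K : ℝ, 0 < K ∧ ∃ δ : ℝ, 0 < δ ∧ ∀ v, 0 ≤ v → v ≤ δ → 1 - K * v ≤ M.p k k v := by
  have h := (hQ.tendsto_one_sub_p_div hk).eventually_le_const (lt_add_one _)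
  obtain ⟨δ, hδ, h⟩ := mem_nhdsGT_iff_exists_Ioc_subset.1 h
  refine ⟨-M.q k k + 1, by linarith [hQ.diag_nonpos k hk], δ, hδ, fun v h0 h1 => ?_⟩
  rcases h0.eq_or_lt with rfl | h0
  · simp [p_zero_self hk]
  · have := h ⟨h0, h1⟩
    rw [mem_ofPred_eq, div_le_iff₀ h0] at this
    linarith

end HasGenerator

end MarkovChain

/-! ### Visits to s on dyadic grids and first-visit decomposition -/

/-- A step path that takes the value `s` on an interval does so on a dyadic grid of it. -/
theorem IsStepPath.exists_grid {w : ℝ → ℤ} (hw : IsStepPath w) {s : ℤ} {a b u : ℝ} (ha : 0 ≤ a)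
    (hau : a ≤ u) (hub : u ≤ b) (hu : w u = s) :
    ∃ m l : ℕ, l ≤ 2 ^ m ∧ w (a + l * ((b - a) / 2 ^ m)) = s := by
  rcases hub.eq_or_lt with rfl | hub
  · exact ⟨0, 1, by simp, by simpa using hu⟩
  obtain ⟨c, hc, hcs⟩ := mem_nhdsGT_iff_exists_Ioo_subset.1 (hw.1 u (ha.trans hau))
  have hab : 0 < b - a := by linarith
  have hd : 0 < min c b - u := by
    rw [sub_pos]
    exact lt_min hc hub
  obtain ⟨m, hm⟩ := ((tendsto_div_two_pow hab).mono_right nhdsWithin_le_nhds |>.eventually_lt_const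
    hd).exists
  set δ := (b - a) / 2 ^ m with hδ
  have hδ0 : 0 < δ := div_pos hab (pow_pos two_pos m)
  -- The first grid point strictly after `u`; the mesh is small enough that it falls where the path
  -- still equals `s`.
  set l := ⌊(u - a) / δ⌋₊ + 1 with hl
  have h1 : u < a + l * δ := by
    have := Nat.lt_floor_add_one ((u - a) / δ)
    rw [div_lt_iff₀ hδ0] at this
    rw [hl]
    push_cast
    linarith
  have h2 : a + l * δ ≤ u + δ := by
    have := Nat.floor_le (div_nonneg (sub_nonneg.2 hau) hδ0.le)
    rw [le_div_iff₀ hδ0] at this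
    rw [hl]
    push_cast
    linarith
  have h3 : a + l * δ < min c b := by linarith
  refine ⟨m, l, ?_, ?_⟩
  · have h4 : (l : ℝ) * δ < 2 ^ m * δ := by
      have : (2 : ℝ) ^ m * δ = b - a := by rw [hδ]; field_simp
      linarith [min_le_right c b]
    have h5 := lt_of_mul_lt_mul_right h4 hδ0.le
    exact_mod_cast h5.le
  · exact (hcs ⟨h1, h3.trans_le (min_le_left c b)⟩).trans hu

namespace MarkovChain

variable {Ω : Type*} [MeasurableSpace Ω] {S : Set ℤ} (M : MarkovChain Ω S)

/-- The chain is at `s` at some point of the dyadic grid of level `m` in `[a, b]`. -/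
def gridVisit (s : ℤ) (a b : ℝ) (m : ℕ) : Set Ω :=
  {ω | ∃ l : ℕ, l < 2 ^ m + 1 ∧ M.X (a + l * ((b - a) / 2 ^ m)) ω = s}

/-- The chain is at `s` at some dyadic point of `[a, b]`. -/
def visits (s : ℤ) (a b : ℝ) : Set Ω := ⋃ m, M.gridVisit s a b m

theorem grid_bounds {a b : ℝ} (hab : a ≤ b) {m l : ℕ} (hl : l < 2 ^ m + 1) :
    a ≤ a + l * ((b - a) / 2 ^ m) ∧ a + l * ((b - a) / 2 ^ m) ≤ b := by
  have hl' : (l : ℝ) ≤ 2 ^ m := by exact_mod_cast Nat.lt_succ_iff.1 hl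
  have h0 : 0 ≤ (b - a) / 2 ^ m := div_nonneg (sub_nonneg.2 hab) (by positivity)
  constructor
  · have : 0 ≤ l * ((b - a) / 2 ^ m) := by positivity
    linarith
  · have : (2 : ℝ) ^ m * ((b - a) / 2 ^ m) = b - a := by field_simp
    nlinarith

theorem monotone_gridVisit (s : ℤ) (a b : ℝ) : Monotone (M.gridVisit s a b) := by
  refine monotone_nat_of_le_succ fun m ω ⟨l, hl, hω⟩ => ⟨2 * l, by rw [pow_succ]; omega, ?_⟩
  rw [← hω]
  congr 2
  rw [pow_succ]
  push_cast
  field_simp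

theorem measurableSet_gridVisit (s : ℤ) {a b : ℝ} (ha : 0 ≤ a) (hab : a ≤ b) (m : ℕ) :
    MeasurableSet[M.past b] (M.gridVisit s a b m) := by
  have e : M.gridVisit s a b m =
      ⋃ l ∈ Finset.range (2 ^ m + 1), {ω | M.X (a + l * ((b - a) / 2 ^ m)) ω ∈ ({s} : Set ℤ)} := by
    ext ω
    simp [gridVisit]
  rw [e]
  refine Finset.measurableSet_biUnion _ fun l hl => ?_
  have h := grid_bounds hab (Finset.mem_range.1 hl)
  exact M.measurableSet_past (ha.trans h.1) h.2 {s}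

theorem measurableSet_visits (s : ℤ) {a b : ℝ} (ha : 0 ≤ a) (hab : a ≤ b) :
    MeasurableSet[M.past b] (M.visits s a b) :=
  MeasurableSet.iUnion fun m => M.measurableSet_gridVisit s ha hab m

theorem X_ne_of_notMem_visits {s : ℤ} {a b : ℝ} {ω : Ω} (h : ω ∉ M.visits s a b) :
    M.X b ω ≠ s := fun hω =>
  h (mem_iUnion.2 ⟨0, 1, by simp, by simpa using hω⟩)

variable {M} {k : ℤ}

/-- Right-continuity identifies the dyadic event, which is measurable with respect to the past, with
a visit at an arbitrary real time. -/
theorem mem_visits_iff {s : ℤ} {a b : ℝ} (ha : 0 ≤ a) (hab : a ≤ b) {ω : Ω}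
    (hω : IsStepPath fun t => M.X t ω) :
    ω ∈ M.visits s a b ↔ ∃ u, a ≤ u ∧ u ≤ b ∧ M.X u ω = s := by
  constructor
  · intro h
    obtain ⟨m, l, hl, h⟩ := mem_iUnion.1 h
    exact ⟨_, (grid_bounds hab hl).1, (grid_bounds hab hl).2, h⟩
  · rintro ⟨u, hau, hub, hu⟩
    obtain ⟨m, l, hl, h⟩ := hω.exists_grid ha hau hub hu
    exact mem_iUnion.2 ⟨m, l, Nat.lt_succ_iff.2 hl, h⟩

/-- Right-continuity makes the infimum harmless: a path with no visit up to `t` keeps its value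
slightly beyond `t`, so its passage time exceeds `t` strictly. -/
theorem passageTime_le_iff {s : ℤ} {t : ℝ} (ht : 0 ≤ t) {ω : Ω}
    (hω : IsStepPath fun t => M.X t ω) :
    M.passageTime s ω ≤ ENNReal.ofReal t ↔ ∃ u, 0 ≤ u ∧ u ≤ t ∧ M.X u ω = s := by
  constructor
  · intro h
    by_contra! hno
    obtain ⟨c, hc, hcs⟩ := mem_nhdsGT_iff_exists_Ioo_subset.1 (hω.1 t ht)
    have hc' : t < c := hc
    have hle : ENNReal.ofReal c ≤ M.passageTime s ω := by
      refine le_iInf₂ fun u hu => ENNReal.ofReal_le_ofReal ?_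
      by_contra! huc
      rcases le_or_gt u t with hut | hut
      · exact hno u hu.1 hut hu.2
      · exact hno t ht le_rfl ((hcs ⟨hut, huc⟩).symm.trans hu.2)
    exact absurd (hle.trans h) (not_le.2 ((ENNReal.ofReal_lt_ofReal_iff (ht.trans_lt hc')).2 hc'))
  · rintro ⟨u, h0, hut, hu⟩
    exact (iInf₂_le u ⟨h0, hu⟩).trans (ENNReal.ofReal_le_ofReal hut)

theorem passageCDF_eq (hk : k ∈ S) (s : ℤ) {t : ℝ} (ht : 0 ≤ t) :
    M.passageCDF k s t = (M.P k).real (M.visits s 0 t) := by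
  refine measureReal_congr ?_
  filter_upwards [M.step_path k hk] with ω hω
  exact propext ((passageTime_le_iff ht hω).trans (mem_visits_iff le_rfl ht hω).symm)

/-- Decomposition at the first visit, along an increasing sequence of times. -/
theorem measure_inter_exists_lt_le {μ ν : Measure Ω} {s : ℤ} {r : ℕ → ℝ} (hr : Monotone r)
    (h0 : 0 ≤ r 0) {A : Set Ω} (hA : MeasurableSet[M.past (r 0)] A) (n : ℕ)
    (h : ∀ l < n, ∀ B, MeasurableSet[M.past (r l)] B →
      μ (B ∩ {ω | M.X (r l) ω = s}) ≤ ν (B ∩ {ω | M.X (r l) ω = s})) :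
    μ (A ∩ {ω | ∃ l < n, M.X (r l) ω = s}) ≤ ν (A ∩ {ω | ∃ l < n, M.X (r l) ω = s}) := by
  induction n with
  | zero => simp
  | succ n ih =>
    have hr0 : ∀ l, 0 ≤ r l := fun l => h0.trans (hr (Nat.zero_le l))
    have hmeas : MeasurableSet[M.past (r n)] {ω | ∃ l < n, M.X (r l) ω = s} := by
      have e : {ω | ∃ l < n, M.X (r l) ω = s} =
          ⋃ l ∈ Finset.range n, {ω | M.X (r l) ω ∈ ({s} : Set ℤ)} := by
        ext ω
        simp
      rw [e]
      exact Finset.measurableSet_biUnion _ fun l hl =>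
        M.measurableSet_past (hr0 l) (hr (Finset.mem_range.1 hl).le) {s}
    have hA' : MeasurableSet[M.past (r n)] A := M.past_mono (hr (Nat.zero_le n)) _ hA
    -- The second piece is a first visit at `r n`; avoidance of `s` before that belongs to the past,
    -- so `h` applies to it.
    have e : A ∩ {ω | ∃ l < n + 1, M.X (r l) ω = s} =
        A ∩ {ω | ∃ l < n, M.X (r l) ω = s} ∪
          A ∩ {ω | ∃ l < n, M.X (r l) ω = s}ᶜ ∩ {ω | M.X (r n) ω = s} := by
      ext ω
      have : (∃ l < n + 1, M.X (r l) ω = s) ↔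
          (∃ l < n, M.X (r l) ω = s) ∨ M.X (r n) ω = s := by
        simp only [Nat.lt_succ_iff_lt_or_eq, or_and_right, exists_or, exists_eq_left]
      simp only [mem_inter_iff, mem_union, mem_compl_iff, mem_ofPred_eq, this]
      generalize (∃ l < n, M.X (r l) ω = s) = P
      tauto
    have hB := hA'.inter hmeas.compl
    rw [e]
    refine (measure_union_le _ _).trans ?_
    rw [measure_union]
    · exact add_le_add (ih fun l hl => h l (hl.trans (Nat.lt_succ_self n))) (h n n.lt_succ_self _ hB)
    · exact Set.disjoint_left.2 fun ω h1 h2 => h2.1.2 h1.2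
    · exact (M.past_le _ _ hB).inter (M.measurableSet_X (hr0 n) {s})

/-- Comparison of two measures that compare at each possible first visit to `s`. -/
theorem measure_inter_visits_le {μ ν : Measure Ω} {s : ℤ} {a b : ℝ} (ha : 0 ≤ a) (hab : a ≤ b)
    {A : Set Ω} (hA : MeasurableSet[M.past a] A)
    (h : ∀ r, a ≤ r → r ≤ b → ∀ B, MeasurableSet[M.past r] B →
      μ (B ∩ {ω | M.X r ω = s}) ≤ ν (B ∩ {ω | M.X r ω = s})) :
    μ (A ∩ M.visits s a b) ≤ ν (A ∩ M.visits s a b) := by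
  have hmono : Monotone fun m => A ∩ M.gridVisit s a b m := fun m n hmn =>
    inter_subset_inter_right _ (M.monotone_gridVisit s a b hmn)
  -- The discrete decomposition passes to the limit along nested grids, so the Markov property at
  -- fixed times suffices.
  rw [visits, inter_iUnion, hmono.measure_iUnion, hmono.measure_iUnion]
  refine iSup_mono fun m => ?_
  refine measure_inter_exists_lt_le (r := fun l : ℕ => a + l * ((b - a) / 2 ^ m)) ?_
    (by simpa using ha) (M.past_mono (by simp) _ hA) _ ?_
  · intro i j hij
    have : 0 ≤ (b - a) / 2 ^ m := div_nonneg (sub_nonneg.2 hab) (by positivity)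
    simp only
    gcongr
  · exact fun l hl B hB => h _ (grid_bounds hab hl).1 (grid_bounds hab hl).2 B hB

end MarkovChain

/-! ### Reflection at s and increments of the passage distribution -/

namespace MarkovChain

variable {Ω : Type*} [MeasurableSpace Ω] {S : Set ℤ} {M : MarkovChain Ω S} {k : ℤ}

/-- Started from `s`, the reflected path picks up the weight x_n/x_s on reaching `n` and x_s/x_n on
returning to `s`; these cancel, which is why a flux that ends at `s` is considered. -/
theorem flux_reflect {s : ℤ} {x : ℤ → ℝ} (hsymm : M.CentralSymmetry (2 * s) x)
    (hS : ∀ n ∈ S, 2 * s - n ∈ S) (hs : s ∈ S) {C C' : Set ℤ} (hC : ∀ n, n ∈ C' ↔ 2 * s - n ∈ C)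
    {u τ : ℝ} (hu : 0 ≤ u) (hτ : 0 ≤ τ) : M.flux s C' s u τ = M.flux s C s u τ := by
  have h := (Equiv.subLeft (2 * s)).hasSum_iff.2 (hasSum_flux (M := M) hs hs C hu hτ)
  refine (hasSum_flux hs hs C' hu hτ).unique ?_
  convert h using 1
  funext n
  have hss : 2 * s - s = s := by ring
  have hg : M.p s (2 * s - n) u * M.p (2 * s - n) s τ = M.p s n u * M.p n s τ := by
    by_cases hn : n ∈ S
    · have h1 := hsymm.2 s hs n hn u hu
      have h2 := hsymm.2 n hn s hs τ hτ
      have h3 := (hsymm.1 s hs).ne'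
      have h4 := (hsymm.1 n hn).ne'
      rw [hss] at h1 h2
      rw [h1, h2]
      field_simp
    · have hn' : 2 * s - n ∉ S := fun h => hn (by simpa using hS _ h)
      rw [p_eq_zero hs hn hu, p_eq_zero hs hn' hu, zero_mul, zero_mul]
  change C'.indicator _ n = C.indicator _ (2 * s - n)
  by_cases hn : n ∈ C'
  · rw [indicator_of_mem hn, indicator_of_mem ((hC n).1 hn), hg]
  · rw [indicator_of_notMem hn, indicator_of_notMem (mt (hC n).2 hn)]

/-- The reflection principle, as an inequality. -/
theorem measure_visits_inter_flux_le {s : ℤ} {x : ℤ → ℝ} (hsymm : M.CentralSymmetry (2 * s) x)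
    (hS : ∀ n ∈ S, 2 * s - n ∈ S) (hs : s ∈ S) (hk : k ∈ S) {C C' : Set ℤ}
    (hC : ∀ n, n ∈ C' ↔ 2 * s - n ∈ C) {t τ : ℝ} (ht : 0 ≤ t) (hτ : 0 ≤ τ) :
    M.P k (M.visits s 0 t ∩ {ω | M.X t ω ∈ C ∧ M.X (t + τ) ω = s}) ≤
      M.P k (M.visits s 0 t ∩ {ω | M.X t ω ∈ C' ∧ M.X (t + τ) ω = s}) := by
  have hP := M.isProbabilityMeasure s hs
  have h := measure_inter_visits_le (M := M) (s := s) (A := univ)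
    (μ := (M.P k).restrict {ω | M.X t ω ∈ C ∧ M.X (t + τ) ω = s})
    (ν := (M.P k).restrict {ω | M.X t ω ∈ C' ∧ M.X (t + τ) ω = s}) le_rfl ht
    MeasurableSet.univ ?_
  · rwa [univ_inter, Measure.restrict_apply' (M.measurableSet_flux C s ht hτ),
      Measure.restrict_apply' (M.measurableSet_flux C' s ht hτ)] at h
  · intro r hr hrt B hB
    have hu : 0 ≤ t - r := sub_nonneg.2 hrt
    rw [Measure.restrict_apply' (M.measurableSet_flux C s ht hτ),
      Measure.restrict_apply' (M.measurableSet_flux C' s ht hτ)]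
    have h1 := markov_flux (M := M) hk hs hs hr hu hτ hB C
    have h2 := markov_flux (M := M) hk hs hs hr hu hτ hB C'
    rw [add_sub_cancel] at h1 h2
    rw [h1, h2, ← ofReal_measureReal (μ := M.P s), ← ofReal_measureReal (μ := M.P s)]
    have h3 := flux_reflect hsymm hS hs hC hu hτ
    rw [flux, flux] at h3
    rw [h3]

/-- Two sets of states on either side of `s`, exchanged by the symmetry and without direct
transitions from the first to the second. -/
structure Sides (M : MarkovChain Ω S) (s : ℤ) (C C' : Set ℤ) : Prop where
  reflect : ∀ n, n ∈ C' ↔ 2 * s - n ∈ C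
  cover : ∀ n, n ∈ C ∨ n = s ∨ n ∈ C'
  disjoint : Disjoint C C'
  notMem : s ∉ C
  q_eq_zero : ∀ i ∈ C, i ∈ S → ∀ j ∈ C', j ∈ S → M.q i j = 0

theorem Sides.notMem' {s : ℤ} {C C' : Set ℤ} (h : M.Sides s C C') : s ∉ C' := by
  rw [h.reflect]
  have : 2 * s - s = s := by ring
  rw [this]
  exact h.notMem

/-- By induction, a sequence that avoids `s` and never steps from `C` into `C'` remains in `C`. -/
theorem exists_step {w : ℕ → ℤ} {s : ℤ} {C C' : Set ℤ} (h : M.Sides s C C') {n : ℕ}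
    (h0 : w 0 ∈ C) (hn : w n ∈ C') (hs : ∀ l ≤ n, w l ≠ s) :
    ∃ l < n, w l ∈ C ∧ w (l + 1) ∈ C' := by
  by_contra! hno
  have : ∀ l ≤ n, w l ∈ C := by
    intro l
    induction l with
    | zero => exact fun _ => h0
    | succ l ih =>
      intro hl
      rcases h.cover (w (l + 1)) with h1 | h1 | h1
      · exact h1
      · exact absurd h1 (hs _ hl)
      · exact absurd h1 (hno l (by omega) (ih (by omega)))
  exact Set.disjoint_left.1 h.disjoint (this n le_rfl) hn

/-- The chain does not get to the other side without visiting `s`. -/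
theorem measure_compl_visits_inter_eq_zero (hQ : M.HasGenerator) {s : ℤ} {C C' : Set ℤ}
    (h : M.Sides s C C') (hk : k ∈ S) (hkC : k ∈ C) {t : ℝ} (ht : 0 < t) :
    M.P k ((M.visits s 0 t)ᶜ ∩ {ω | M.X t ω ∈ C'}) = 0 := by
  classical
  have hP := M.isProbabilityMeasure k hk
  -- Confining the path to finitely many states keeps the union bound over pairs (i, j) a finite
  -- sum.
  set Z : ℕ → Set Ω := fun N => {ω | ω ∉ M.visits s 0 t ∧ M.X t ω ∈ C' ∧ M.X 0 ω = k ∧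
    ∀ u, 0 ≤ u → u ≤ t → |M.X u ω| ≤ N ∧ M.X u ω ∈ S} with hZ
  have hZ0 : ∀ N, M.P k (Z N) = 0 := by
    intro N
    set F := (Finset.Icc (-N : ℤ) N).filter fun n => n ∈ S with hF
    set I := F.filter fun n => n ∈ C with hI
    set J := F.filter fun n => n ∈ C' with hJ
    -- Some grid step jumps from `I` to `J`. For each pair there are 2^m steps of probability at
    -- most p_{i,j}(t/2^m), and the total tends to t q_{i,j} = 0.
    have hle : ∀ m : ℕ, M.P k (Z N) ≤
        ENNReal.ofReal (∑ i ∈ I, ∑ j ∈ J, 2 ^ m * M.p i j (t / 2 ^ m)) := by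
      intro m
      set δ := t / 2 ^ m with hδ
      have hδ0 : 0 < δ := div_pos ht (pow_pos two_pos m)
      have hlast : ((2 ^ m : ℕ) : ℝ) * δ = t := by
        rw [hδ]
        push_cast
        field_simp
      have hsub : Z N ⊆ ⋃ i ∈ I, ⋃ j ∈ J, ⋃ l ∈ Finset.range (2 ^ m),
          {ω | M.X (l * δ) ω ∈ ({i} : Set ℤ) ∧ M.X (l * δ + δ) ω = j} := by
        rintro ω ⟨hv, htC, h0, hω⟩
        obtain ⟨l, hl, h1, h2⟩ := exists_step (w := fun l => M.X (l * δ) ω) h (n := 2 ^ m)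
          (by simpa [h0] using hkC) (by simpa only [hlast] using htC) (fun l hl hls => hv
            (mem_iUnion.2 ⟨m, l, Nat.lt_succ_iff.2 hl, by simpa using hls⟩))
        have hl1 : ((l + 1 : ℕ) : ℝ) * δ ≤ t := by
          rw [← hlast]
          gcongr
          exact hl
        have e : ((l + 1 : ℕ) : ℝ) * δ = l * δ + δ := by push_cast; ring
        simp only [e] at h2
        rw [e] at hl1
        have hb1 := hω (l * δ) (by positivity) (by linarith)
        have hb2 := hω (l * δ + δ) (by positivity) hl1
        rw [abs_le] at hb1 hb2
        simp only [mem_iUnion]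
        exact ⟨M.X (l * δ) ω, Finset.mem_filter.2 ⟨Finset.mem_filter.2
          ⟨Finset.mem_Icc.2 hb1.1, hb1.2⟩, h1⟩, M.X (l * δ + δ) ω, Finset.mem_filter.2
          ⟨Finset.mem_filter.2 ⟨Finset.mem_Icc.2 hb2.1, hb2.2⟩, h2⟩, l, Finset.mem_range.2 hl,
          rfl, rfl⟩
      refine (measure_mono hsub).trans ((measure_biUnion_finset_le _ _).trans ?_)
      have hnn : ∀ i j, 0 ≤ 2 ^ m * M.p i j δ := fun i j => mul_nonneg (by positivity)
        (p_nonneg j δ)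
      rw [ENNReal.ofReal_sum_of_nonneg fun i _ => Finset.sum_nonneg fun j _ => hnn i j]
      refine Finset.sum_le_sum fun i hi => (measure_biUnion_finset_le _ _).trans ?_
      rw [ENNReal.ofReal_sum_of_nonneg fun j _ => hnn i j]
      refine Finset.sum_le_sum fun j hj => (measure_biUnion_finset_le _ _).trans ?_
      have hjS : j ∈ S := (Finset.mem_filter.1 (Finset.mem_filter.1 hj).1).2
      have hfl : ∀ l : ℕ, M.flux k {i} j (l * δ) δ ≤ M.p i j δ := by
        intro l
        have hs1 := hasSum_flux (M := M) hk hjS {i} (by positivity : 0 ≤ l * δ) hδ0.le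
        have e : (({i} : Set ℤ).indicator fun n => M.p k n (l * δ) * M.p n j δ) =
            fun n => if n = i then M.p k i (l * δ) * M.p i j δ else 0 := by
          funext n
          by_cases hn : n = i
          · subst hn; simp
          · simp [hn]
        rw [e] at hs1
        rw [hs1.unique (hasSum_ite_eq i _)]
        exact mul_le_of_le_one_left (p_nonneg _ _) (p_le_one hk _ _)
      calc ∑ l ∈ Finset.range (2 ^ m),
            M.P k {ω | M.X (l * δ) ω ∈ ({i} : Set ℤ) ∧ M.X (l * δ + δ) ω = j}
          ≤ ∑ l ∈ Finset.range (2 ^ m), ENNReal.ofReal (M.p i j δ) := by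
            refine Finset.sum_le_sum fun l _ => ?_
            rw [← ofReal_measureReal (μ := M.P k)]
            exact ENNReal.ofReal_le_ofReal (hfl l)
        _ = ENNReal.ofReal (2 ^ m * M.p i j δ) := by
            rw [Finset.sum_const, Finset.card_range, nsmul_eq_mul,
              ENNReal.ofReal_mul (by positivity), ENNReal.ofReal_pow (by norm_num)]
            simp
    have hlim : Tendsto (fun m : ℕ => ∑ i ∈ I, ∑ j ∈ J, 2 ^ m * M.p i j (t / 2 ^ m)) atTop
        (𝓝 (∑ i ∈ I, ∑ j ∈ J, (0 : ℝ))) := by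
      refine tendsto_finsetSum _ fun i hi => tendsto_finsetSum _ fun j hj => ?_
      obtain ⟨hi1, hiC⟩ := Finset.mem_filter.1 hi
      obtain ⟨hj1, hjC⟩ := Finset.mem_filter.1 hj
      have hiS := (Finset.mem_filter.1 hi1).2
      have hjS := (Finset.mem_filter.1 hj1).2
      have hne : j ≠ i := fun e => Set.disjoint_left.1 h.disjoint hiC (e ▸ hjC)
      have h1 := ((hQ.tendsto_p_div hiS hne).comp (tendsto_div_two_pow ht)).const_mul t
      rw [h.q_eq_zero i hiC hiS j hjC hjS, mul_zero] at h1
      refine h1.congr fun m => ?_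
      simp only [Function.comp_apply]
      field_simp
    have h2 := (ENNReal.continuous_ofReal.tendsto _).comp hlim
    simp only [Finset.sum_const_zero, ENNReal.ofReal_zero] at h2
    exact le_antisymm (ge_of_tendsto h2 (Eventually.of_forall hle)) zero_le
  rw [← nonpos_iff_eq_zero, ← measure_iUnion_null hZ0]
  refine measure_mono_ae ?_
  filter_upwards [M.step_path k hk, M.start k hk, M.mem_state k hk] with ω h1 h2 h3 h4
  obtain ⟨B, hB⟩ := h1.exists_bound t
  refine mem_iUnion.2 ⟨B.toNat, h4.1, h4.2, h2, fun u h0 hu => ⟨?_, h3 u h0⟩⟩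
  exact (hB u h0 hu).trans (Int.self_le_toNat B)

/-- The probability of being at `s` at time `t + τ`, without a visit up to time `t`. -/
theorem measureReal_compl_visits_inter (hQ : M.HasGenerator) {s : ℤ} {x : ℤ → ℝ}
    (hsymm : M.CentralSymmetry (2 * s) x) (hS : ∀ n ∈ S, 2 * s - n ∈ S) (hs : s ∈ S)
    {C C' : Set ℤ} (h : M.Sides s C C') (hk : k ∈ S) (hkC : k ∈ C) {t τ : ℝ} (ht : 0 < t)
    (hτ : 0 ≤ τ) :
    (M.P k).real ((M.visits s 0 t)ᶜ ∩ {ω | M.X (t + τ) ω = s}) =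
      M.flux k C s t τ - M.flux k C' s t τ := by
  have hP := M.isProbabilityMeasure k hk
  have hC : ∀ n, n ∈ C ↔ 2 * s - n ∈ C' := fun n => by rw [h.reflect]; simp
  have hV := M.past_le t _ (M.measurableSet_visits s le_rfl ht.le)
  set V := M.visits s 0 t with hVdef
  set W := {ω | M.X t ω ∈ C ∧ M.X (t + τ) ω = s} with hW
  set W' := {ω | M.X t ω ∈ C' ∧ M.X (t + τ) ω = s} with hW'
  have hz := measure_compl_visits_inter_eq_zero hQ h hk hkC ht
  -- The reflection inequality applied in both directions.
  have e1 : (M.P k).real (W ∩ V) = (M.P k).real (W' ∩ V) := by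
    rw [inter_comm W, inter_comm W', Measure.real, Measure.real,
      le_antisymm (measure_visits_inter_flux_le hsymm hS hs hk h.reflect ht.le hτ)
      (measure_visits_inter_flux_le hsymm hS hs hk hC ht.le hτ)]
  have e2 : (M.P k).real (W' \ V) = 0 := by
    have hsub : W' \ V ⊆ Vᶜ ∩ {ω | M.X t ω ∈ C'} := fun ω hω => ⟨hω.2, hω.1.1⟩
    rw [Measure.real, measure_mono_null hsub hz, ENNReal.toReal_zero]
  have e3 : (M.P k).real (Vᶜ ∩ {ω | M.X (t + τ) ω = s}) = (M.P k).real (W \ V) := by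
    refine measureReal_congr ?_
    filter_upwards [measure_eq_zero_iff_ae_notMem.1 hz] with ω hω
    refine propext ⟨fun hv => ⟨⟨?_, hv.2⟩, hv.1⟩, fun hv => ⟨hv.2, hv.1.2⟩⟩
    rcases h.cover (M.X t ω) with h1 | h1 | h1
    · exact h1
    · exact absurd h1 (M.X_ne_of_notMem_visits hv.1)
    · exact absurd ⟨hv.1, h1⟩ hω
  have e4 := measureReal_inter_add_sdiff (μ := M.P k) (s := W) hV
  have e5 := measureReal_inter_add_sdiff (μ := M.P k) (s := W') hV
  rw [e3, flux, flux]
  linarith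

theorem passageCDF_sub (hk : k ∈ S) (s : ℤ) {t τ : ℝ} (ht : 0 ≤ t) (hτ : 0 ≤ τ) :
    M.passageCDF k s (t + τ) - M.passageCDF k s t =
      (M.P k).real ((M.visits s 0 t)ᶜ ∩ M.visits s t (t + τ)) := by
  have hP := M.isProbabilityMeasure k hk
  have hV := M.past_le t _ (M.measurableSet_visits s le_rfl ht)
  rw [passageCDF_eq hk s (add_nonneg ht hτ), passageCDF_eq hk s ht]
  have e : (M.P k).real (M.visits s 0 (t + τ)) =
      (M.P k).real (M.visits s 0 t ∪ M.visits s t (t + τ)) := by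
    refine measureReal_congr ?_
    filter_upwards [M.step_path k hk] with ω hω
    refine propext ?_
    change ω ∈ M.visits s 0 (t + τ) ↔ ω ∈ M.visits s 0 t ∨ ω ∈ M.visits s t (t + τ)
    rw [mem_visits_iff le_rfl (add_nonneg ht hτ) hω, mem_visits_iff le_rfl ht hω,
      mem_visits_iff ht (by linarith) hω]
    constructor
    · rintro ⟨u, h0, h1, h2⟩
      rcases le_total u t with hu | hu
      · exact Or.inl ⟨u, h0, hu, h2⟩
      · exact Or.inr ⟨u, hu, h1, h2⟩
    · rintro (⟨u, h0, h1, h2⟩ | ⟨u, h0, h1, h2⟩)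
      · exact ⟨u, h0, by linarith, h2⟩
      · exact ⟨u, by linarith, h1, h2⟩
  have e2 := measureReal_inter_add_sdiff (μ := M.P k)
    (s := M.visits s 0 t ∪ M.visits s t (t + τ)) hV
  have e3 : (M.visits s 0 t)ᶜ ∩ M.visits s t (t + τ) =
      (M.visits s 0 t ∪ M.visits s t (t + τ)) \ M.visits s 0 t := by
    rw [union_sdiff_left, sdiff_eq, inter_comm]
  rw [e, e3, ← e2, union_inter_cancel_left]
  ring

theorem measureReal_le_passageCDF_sub (hk : k ∈ S) (s : ℤ) {t τ : ℝ} (ht : 0 ≤ t) (hτ : 0 ≤ τ) :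
    (M.P k).real ((M.visits s 0 t)ᶜ ∩ {ω | M.X (t + τ) ω = s}) ≤
      M.passageCDF k s (t + τ) - M.passageCDF k s t := by
  have hP := M.isProbabilityMeasure k hk
  rw [passageCDF_sub hk s ht hτ]
  refine measureReal_mono fun ω hω => ⟨hω.1, ?_⟩
  by_contra hv
  exact M.X_ne_of_notMem_visits hv hω.2

/-- Decompose at the first visit in [t, t+τ]: from there the chain is at `s` again at time t+τ with
probability at least `c`. This is the converse, up to `c`, of the trivial bound
`measureReal_le_passageCDF_sub`. -/
theorem mul_passageCDF_sub_le (hk : k ∈ S) {s : ℤ} (hs : s ∈ S) {t τ c : ℝ} (ht : 0 ≤ t)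
    (hτ : 0 ≤ τ) (hc0 : 0 ≤ c) (hc : ∀ v, 0 ≤ v → v ≤ τ → c ≤ M.p s s v) :
    c * (M.passageCDF k s (t + τ) - M.passageCDF k s t) ≤
      (M.P k).real ((M.visits s 0 t)ᶜ ∩ {ω | M.X (t + τ) ω = s}) := by
  have hP := M.isProbabilityMeasure k hk
  have hPs := M.isProbabilityMeasure s hs
  have hms : MeasurableSet {ω | M.X (t + τ) ω = s} := M.measurableSet_X (add_nonneg ht hτ) {s}
  rw [passageCDF_sub hk s ht hτ]
  have h := measure_inter_visits_le (M := M) (s := s) (A := (M.visits s 0 t)ᶜ)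
    (μ := ENNReal.ofReal c • M.P k) (ν := (M.P k).restrict {ω | M.X (t + τ) ω = s}) ht
    (le_add_of_nonneg_right hτ) (M.measurableSet_visits s le_rfl ht).compl ?_
  · rw [Measure.smul_apply, smul_eq_mul, Measure.restrict_apply' hms] at h
    have h2 := ENNReal.toReal_mono (measure_ne_top _ _) h
    rw [ENNReal.toReal_mul, ENNReal.toReal_ofReal hc0] at h2
    exact h2.trans (measureReal_mono fun ω hω => ⟨hω.1.1, hω.2⟩)
  · intro r hr hrt B hB
    have hr0 := ht.trans hr
    have h1 := M.markov k hk s hs s hs r (t + τ - r) hr0 (sub_nonneg.2 hrt) B hB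
    rw [add_sub_cancel] at h1
    rw [Measure.smul_apply, smul_eq_mul, Measure.restrict_apply' hms, h1, mul_comm]
    gcongr
    rw [← ofReal_measureReal (μ := M.P s)]
    exact ENNReal.ofReal_le_ofReal (hc _ (sub_nonneg.2 hrt) (by linarith))

end MarkovChain

/-! ### The distribution function and its density -/

namespace MarkovChain

variable {Ω : Type*} [MeasurableSpace Ω] {S : Set ℤ} {M : MarkovChain Ω S} {k : ℤ}

theorem passageCDF_mono (hk : k ∈ S) (s : ℤ) {t τ : ℝ} (ht : 0 ≤ t) (hτ : 0 ≤ τ) :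
    M.passageCDF k s t ≤ M.passageCDF k s (t + τ) := by
  rw [← sub_nonneg, passageCDF_sub hk s ht hτ]
  exact measureReal_nonneg

theorem passageCDF_zero (hk : k ∈ S) {s : ℤ} (hks : k ≠ s) : M.passageCDF k s 0 = 0 := by
  rw [passageCDF_eq hk s le_rfl, Measure.real, measure_mono_null (t := {ω | M.X 0 ω = s}),
    ENNReal.toReal_zero]
  · intro ω hω
    obtain ⟨m, l, -, h⟩ := mem_iUnion.1 hω
    simpa using h
  · exact measure_eq_zero_iff_ae_notMem.2 <|
      (M.start k hk).mono fun _ h hω => hks (h.symm.trans hω)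

/-- A right derivative alone does not determine a function; continuity, including at 0, is needed
for the fundamental theorem. It follows from a Lipschitz bound on short increments, where `K`
controls the loss from `s` and `K'` the variation of p_{k,s}. -/
theorem continuousOn_passageCDF (hQ : M.HasGenerator) (hk : k ∈ S) {s : ℤ} (hs : s ∈ S) :
    ContinuousOn (M.passageCDF k s) (Ici 0) := by
  have hP := M.isProbabilityMeasure k hk
  obtain ⟨K, hK, δ, hδ, h⟩ := hQ.exists_one_sub_mul_le hs
  obtain ⟨K', hK', δ', hδ', h'⟩ := hQ.exists_one_sub_mul_le hk
  -- The term 1/(2K) ensures p_{s,s} ≥ 1/2 on [0, τ], which is the source of the factor 2 below.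
  set η := min (min δ δ') (1 / (2 * K)) with hη
  have hη0 : 0 < η := lt_min (lt_min hδ hδ') (by positivity)
  have hbound : ∀ t τ : ℝ, 0 ≤ t → 0 ≤ τ → τ < η →
      M.passageCDF k s (t + τ) - M.passageCDF k s t ≤ 2 * (K + K') * τ := by
    intro t τ ht hτ hτη
    have hτδ : τ ≤ δ := hτη.le.trans ((min_le_left _ _).trans (min_le_left _ _))
    have hτδ' : τ ≤ δ' := hτη.le.trans ((min_le_left _ _).trans (min_le_right _ _))
    have hKτ : K * τ ≤ 1 / 2 := by
      have : τ ≤ 1 / (2 * K) := hτη.le.trans (min_le_right _ _)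
      rw [le_div_iff₀ (by positivity)] at this
      linarith
    have h1 := mul_passageCDF_sub_le (M := M) (c := 1 / 2) hk hs ht hτ (by norm_num)
      fun v h0 hv => by
        have := h v h0 (hv.trans hτδ)
        nlinarith
    have h2 : (M.P k).real ((M.visits s 0 t)ᶜ ∩ {ω | M.X (t + τ) ω = s}) ≤
        M.flux k {s}ᶜ s t τ :=
      measureReal_mono fun ω hω => ⟨M.X_ne_of_notMem_visits hω.1, hω.2⟩
    rw [flux_compl_singleton hk hs ht hτ] at h2
    have h3 := (abs_le.1 (abs_p_add_sub_le (M := M) hk hs ht hτ)).2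
    have h4 := h τ hτ hτδ
    have h5 := h' τ hτ hτδ'
    have h6 := p_nonneg (M := M) (k := k) s t
    have h7 := p_le_one (M := M) hk s t
    have h8 := p_le_one (M := M) hs s τ
    nlinarith
  intro t ht
  rw [ContinuousWithinAt, tendsto_iff_norm_sub_tendsto_zero]
  refine squeeze_zero' (g := fun u => 2 * (K + K') * |u - t|)
    (Eventually.of_forall fun u => norm_nonneg _) ?_ ?_
  · have hnear : ∀ᶠ u in 𝓝[Ici 0] t, |u - t| < η :=
      mem_nhdsWithin_of_mem_nhds (Metric.ball_mem_nhds t hη0)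
    filter_upwards [hnear, eventually_mem_nhdsWithin] with u hu hu0
    rcases le_total t u with htu | hut
    · have h0 := sub_nonneg.2 htu
      rw [abs_of_nonneg h0] at hu ⊢
      have h1 := hbound t (u - t) ht h0 hu
      have h2 := passageCDF_mono (M := M) hk s ht h0
      rw [add_sub_cancel] at h1 h2
      rwa [Real.norm_of_nonneg (sub_nonneg.2 h2)]
    · have h0 := sub_nonneg.2 hut
      rw [abs_sub_comm, abs_of_nonneg h0] at hu ⊢
      have h1 := hbound u (t - u) hu0 h0 hu
      have h2 := passageCDF_mono (M := M) hk s hu0 h0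
      rw [add_sub_cancel] at h1 h2
      rwa [norm_sub_rev, Real.norm_of_nonneg (sub_nonneg.2 h2)]
  · have h : Continuous fun u : ℝ => 2 * (K + K') * |u - t| := by fun_prop
    simpa using (h.tendsto t).mono_left nhdsWithin_le_nhds

section Density

variable {s : ℤ} {x : ℤ → ℝ} {C C' : Set ℤ}

theorem tendsto_compl_visits_div (hQ : M.HasGenerator) (hsymm : M.CentralSymmetry (2 * s) x)
    (hS : ∀ n ∈ S, 2 * s - n ∈ S) (hs : s ∈ S) (h : M.Sides s C C') (hk : k ∈ S) (hkC : k ∈ C)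
    {t : ℝ} (ht : 0 < t) :
    Tendsto (fun τ => (M.P k).real ((M.visits s 0 t)ᶜ ∩ {ω | M.X (t + τ) ω = s}) / τ) (𝓝[>] 0)
      (𝓝 (M.current k C s t - M.current k C' s t)) := by
  refine ((hQ.tendsto_flux_div hk hs h.notMem ht.le).sub
    (hQ.tendsto_flux_div hk hs h.notMem' ht.le)).congr'
    (eventually_mem_nhdsWithin.mono fun τ (hτ : 0 < τ) => ?_)
  simp only [measureReal_compl_visits_inter hQ hsymm hS hs h hk hkC ht hτ.le, sub_div]

/-- The increment of the distribution function lies between the probability of no visit up to `t`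
and X(t+τ) = s, and that probability divided by 1 − Kτ; both bounds have the same slope at τ = 0. -/
theorem hasDerivWithinAt_passageCDF (hQ : M.HasGenerator) (hsymm : M.CentralSymmetry (2 * s) x)
    (hS : ∀ n ∈ S, 2 * s - n ∈ S) (hs : s ∈ S) (h : M.Sides s C C') (hk : k ∈ S) (hkC : k ∈ C)
    {t : ℝ} (ht : 0 < t) :
    HasDerivWithinAt (M.passageCDF k s) (M.current k C s t - M.current k C' s t) (Ioi t) t := by
  have hlow := tendsto_compl_visits_div hQ hsymm hS hs h hk hkC ht
  obtain ⟨K, hK, δ, hδ, hp⟩ := hQ.exists_one_sub_mul_le hs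
  have hK1 : Tendsto (fun τ => 1 - K * τ) (𝓝[>] 0) (𝓝 1) := by
    have : Continuous fun τ : ℝ => 1 - K * τ := by fun_prop
    simpa using (this.tendsto 0).mono_left nhdsWithin_le_nhds
  have hup := hlow.div hK1 one_ne_zero
  rw [div_one] at hup
  have hslope : Tendsto (fun τ => (M.passageCDF k s (t + τ) - M.passageCDF k s t) / τ) (𝓝[>] 0)
      (𝓝 (M.current k C s t - M.current k C' s t)) := by
    refine tendsto_of_tendsto_of_tendsto_of_le_of_le' hlow hup ?_ ?_
    · filter_upwards [eventually_mem_nhdsWithin] with τ (hτ : 0 < τ)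
      gcongr
      exact measureReal_le_passageCDF_sub hk s ht.le hτ.le
    · filter_upwards [eventually_mem_nhdsWithin, hK1.eventually_const_lt zero_lt_one,
        mem_nhdsWithin_of_mem_nhds (Iio_mem_nhds hδ)] with τ (hτ : 0 < τ) h1 (h2 : τ < δ)
      rw [Pi.div_apply, le_div_iff₀ h1, div_mul_eq_mul_div, mul_comm]
      gcongr
      refine mul_passageCDF_sub_le hk hs ht.le hτ.le h1.le fun v h0 hv => ?_
      refine le_trans ?_ (hp v h0 (hv.trans h2.le))
      gcongr
  rw [hasDerivWithinAt_iff_tendsto_slope' (by simp)]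
  have hshift : Tendsto (fun u => u - t) (𝓝[>] t) (𝓝[>] 0) := by
    refine tendsto_nhdsWithin_iff.2 ⟨?_, ?_⟩
    swap
    · exact eventually_mem_nhdsWithin.mono fun u (hu : t < u) => mem_Ioi.2 (sub_pos.2 hu)
    have : Continuous fun u : ℝ => u - t := by fun_prop
    simpa using (this.tendsto t).mono_left nhdsWithin_le_nhds
  refine (hslope.comp hshift).congr fun u => ?_
  rw [Function.comp_apply, add_sub_cancel, slope_def_field]

/-- The first-passage density is the difference of the two probability currents. -/
theorem isPassageDensity_g (hQ : M.HasGenerator) (hsymm : M.CentralSymmetry (2 * s) x)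
    (hS : ∀ n ∈ S, 2 * s - n ∈ S) (hs : s ∈ S) (h : M.Sides s C C') (hk : k ∈ S) (hkC : k ∈ C) :
    M.IsPassageDensity k s (M.g k s) ∧
      ∀ t, 0 < t → M.g k s t = M.current k C s t - M.current k C' s t := by
  have hks : k ≠ s := by rintro rfl; exact h.notMem hkC
  set f : ℝ → ℝ := fun t => M.current k C s t - M.current k C' s t with hf
  have hfc : ContinuousOn f (Ici 0) :=
    (hQ.continuousOn_current hk hs h.notMem).sub (hQ.continuousOn_current hk hs h.notMem')
  -- The sign is not visible from a difference of currents; it comes from the difference being a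
  -- limit of probabilities over τ.
  have hf0 : ∀ t, 0 < t → 0 ≤ f t := fun t ht =>
    ge_of_tendsto (tendsto_compl_visits_div hQ hsymm hS hs h hk hkC ht)
      (eventually_mem_nhdsWithin.mono fun τ (hτ : 0 < τ) => div_nonneg measureReal_nonneg hτ.le)
  have hsub : ∀ t : ℝ, 0 ≤ t → uIcc 0 t ⊆ Ici 0 := fun t ht u hu => by
    rw [uIcc_of_le ht] at hu
    exact hu.1
  have hint : ∀ t : ℝ, 0 ≤ t → IntervalIntegrable f volume 0 t := fun t ht =>
    (hfc.mono (hsub t ht)).intervalIntegrable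
  have hG : ∀ t, 0 ≤ t → ∫ u in (0 : ℝ)..t, f u = M.passageCDF k s t := by
    intro t ht
    rw [intervalIntegral.integral_eq_sub_of_hasDeriv_right
      ((continuousOn_passageCDF hQ hk hs).mono (hsub t ht)) (fun u hu => ?_) (hint t ht),
      passageCDF_zero hk hks, sub_zero]
    rw [min_eq_left ht] at hu
    exact hasDerivWithinAt_passageCDF hQ hsymm hS hs h hk hkC hu.1
  have hg : ∀ t, 0 < t → M.g k s t = f t := by
    intro t ht
    -- Continuity of `f` upgrades the right derivative to a two-sided one, which `g` requires.
    have hd := intervalIntegral.integral_hasDerivAt_right (hint t ht.le)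
      ((hfc.mono Ioi_subset_Ici_self).stronglyMeasurableAtFilter isOpen_Ioi t ht)
      (hfc.continuousAt (Ici_mem_nhds ht))
    refine (hd.congr_of_eventuallyEq ?_).deriv
    filter_upwards [Ioi_mem_nhds ht] with u hu
    exact (hG u (le_of_lt hu)).symm
  refine ⟨⟨?_, fun t ht => (hf0 t ht).trans_eq (hg t ht).symm, fun t ht => ?_⟩, hg⟩
  · exact (hfc.mono Ioi_subset_Ici_self).congr fun t ht => hg t ht
  · rw [setLIntegral_congr_fun measurableSet_Ioc fun u hu => by rw [hg u hu.1], ← hG t ht,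
      intervalIntegral.integral_of_le ht]
    refine ofReal_integral_eq_lintegral_ofReal
      ((intervalIntegrable_iff_integrableOn_Ioc_of_le ht).1 (hint t ht)) ?_
    exact (ae_restrict_mem measurableSet_Ioc).mono fun u hu => hf0 u hu.1

end Density

/-! ### Currents through the half-lines, their symmetry, and assembly -/

/-- The argument is run with half-lines of ℤ, which reflection exchanges and which together with `s`
cover ℤ; states outside `S` have probability zero. -/
theorem indicator_Iio_eq (hk : k ∈ S) (s : ℤ) {t : ℝ} (ht : 0 ≤ t) (f : ℤ → ℝ) :
    (Iio s).indicator (fun i => M.p k i t * f i) =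
      (below S s).indicator fun i => M.p k i t * f i := by
  funext i
  by_cases hi : i ∈ S
  · simp [indicator, below, hi]
  · simp [indicator, p_eq_zero hk hi ht]

theorem indicator_Ioi_eq (hk : k ∈ S) (s : ℤ) {t : ℝ} (ht : 0 ≤ t) (f : ℤ → ℝ) :
    (Ioi s).indicator (fun i => M.p k i t * f i) =
      (above S s).indicator fun i => M.p k i t * f i := by
  funext i
  by_cases hi : i ∈ S
  · simp [indicator, above, hi]
  · simp [indicator, p_eq_zero hk hi ht]

theorem hUp_eq_current (hk : k ∈ S) (s : ℤ) {t : ℝ} (ht : 0 ≤ t) :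
    M.hUp k s t = M.current k (Iio s) s t := by
  rw [current, indicator_Iio_eq hk s ht]
  exact tsum_subtype (below S s) fun i => M.p k i t * M.q i s

theorem hDown_eq_current (hk : k ∈ S) (s : ℤ) {t : ℝ} (ht : 0 ≤ t) :
    M.hDown k s t = M.current k (Ioi s) s t := by
  rw [current, indicator_Ioi_eq hk s ht]
  exact tsum_subtype (above S s) fun i => M.p k i t * M.q i s

theorem CentralSymmetry.q_reflect {N : ℤ} {x : ℤ → ℝ} (hQ : M.HasGenerator)
    (hsymm : M.CentralSymmetry N x) {n : ℤ} (hk : k ∈ S) (hn : n ∈ S) :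
    M.q (N - k) (N - n) = x n / x k * M.q k n := by
  have h1 := (hQ.hasDerivWithinAt_p hk n).const_mul (x n / x k)
  have h2 := h1.congr (fun t ht => hsymm.2 k hk n hn t ht) (hsymm.2 k hk n hn 0 le_rfl)
  exact h2.derivWithin (uniqueDiffOn_Ici 0 0 self_mem_Ici)

/-- Reindex by n ↦ 2s − n; the weights multiply to (x_n/x_k)(x_s/x_n) = x_s/x_k, the same for every
term. -/
theorem CentralSymmetry.hDown_reflect {s : ℤ} {x : ℤ → ℝ} (hQ : M.HasGenerator)
    (hsymm : M.CentralSymmetry (2 * s) x) (hS : ∀ n ∈ S, 2 * s - n ∈ S) (hs : s ∈ S) (hk : k ∈ S)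
    {t : ℝ} (ht : 0 ≤ t) : M.hDown (2 * s - k) s t = x s / x k * M.hUp k s t := by
  rw [hDown_eq_current (hS k hk) s ht, hUp_eq_current hk s ht, current, current, ← tsum_mul_left,
    ← (Equiv.subLeft (2 * s)).tsum_eq]
  refine tsum_congr fun n => ?_
  have hss : 2 * s - s = s := by ring
  have hmem : 2 * s - n ∈ Ioi s ↔ n ∈ Iio s := by
    simp only [mem_Ioi, mem_Iio]
    omega
  change (Ioi s).indicator _ (2 * s - n) = _
  by_cases hn : n ∈ Iio s
  · rw [indicator_of_mem hn, indicator_of_mem (hmem.2 hn)]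
    by_cases hnS : n ∈ S
    · have hq := hsymm.q_reflect hQ hnS hs
      rw [hss] at hq
      have h1 := (hsymm.1 n hnS).ne'
      have h2 := (hsymm.1 k hk).ne'
      rw [hq, hsymm.2 k hk n hnS t ht]
      field_simp
    · have hn' : 2 * s - n ∉ S := fun h => hnS (by simpa using hS _ h)
      simp [p_eq_zero hk hnS ht, p_eq_zero (hS k hk) hn' ht]
  · rw [indicator_of_notMem hn, indicator_of_notMem (mt hmem.1 hn), mul_zero]

theorem Separates.sides_below {s : ℤ} (h : M.Separates s) : M.Sides s (Iio s) (Ioi s) where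
  reflect n := by simp only [mem_Ioi, mem_Iio]; omega
  cover n := by simp only [mem_Ioi, mem_Iio]; omega
  disjoint := Set.disjoint_left.2 fun n h1 h2 => lt_asymm (mem_Iio.1 h1) (mem_Ioi.1 h2)
  notMem := by simp
  q_eq_zero i hi hiS j hj hjS := (h.no_jump i ⟨hiS, hi⟩ j ⟨hjS, hj⟩).1

theorem Separates.sides_above {s : ℤ} (h : M.Separates s) : M.Sides s (Ioi s) (Iio s) where
  reflect n := by simp only [mem_Ioi, mem_Iio]; omega
  cover n := by simp only [mem_Ioi, mem_Iio]; omega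
  disjoint := Set.disjoint_left.2 fun n h1 h2 => lt_asymm (mem_Iio.1 h2) (mem_Ioi.1 h1)
  notMem := by simp
  q_eq_zero i hi hiS j hj hjS := (h.no_jump j ⟨hjS, hj⟩ i ⟨hiS, hi⟩).2

end MarkovChain

theorem theorem3p1 {Ω : Type*} [MeasurableSpace Ω] (S : Set ℤ) (s : ℤ)
    (hS : S = Set.Icc 0 (2 * s) ∨ S = Set.univ)
    (M : MarkovChain Ω S) (hQ : M.HasGenerator)
    (x : ℤ → ℝ) (hsymm : M.CentralSymmetry (2 * s) x)
    (hsep : M.Separates s)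
    (hirr_below : M.IrreducibleOn (below S s)) (hirr_above : M.IrreducibleOn (above S s)) :
    -- the currents are well defined: the series converge and are the limits of the flux quotients
    (∀ k ∈ S, ∀ t : ℝ, 0 < t →
      Summable (fun i : below S s => M.p k i t * M.q i s) ∧
      Summable (fun j : above S s => M.p k j t * M.q j s) ∧
      Tendsto (fun τ : ℝ => (M.P k).real {ω | M.X (t + τ) ω = s ∧ M.X t ω < s} / τ)
        (𝓝[>] 0) (𝓝 (M.hUp k s t)) ∧
      Tendsto (fun τ : ℝ => (M.P k).real {ω | M.X (t + τ) ω = s ∧ s < M.X t ω} / τ)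
        (𝓝[>] 0) (𝓝 (M.hDown k s t))) ∧
    -- symmetry of the currents
    (∀ k ∈ S, ∀ t : ℝ, 0 < t → M.hDown (2 * s - k) s t = x s / x k * M.hUp k s t) ∧
    -- upward first-passage densities
    (∀ i ∈ below S s, M.IsPassageDensity i s (M.g i s) ∧
      ∀ t : ℝ, 0 < t → M.g i s t = M.hUp i s t - M.hDown i s t) ∧
    -- downward first-passage densities
    (∀ j ∈ above S s, M.IsPassageDensity j s (M.g j s) ∧
      ∀ t : ℝ, 0 < t → M.g j s t = M.hDown j s t - M.hUp j s t) := by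

  have hrefl : ∀ n ∈ S, 2 * s - n ∈ S := by
    rcases hS with rfl | rfl
    · intro n hn
      rw [mem_Icc] at hn ⊢
      omega
    · exact fun n _ => mem_univ _
  -- For s < 0 the interval is empty, so `s ∈ S` has to be drawn from the existence of some state.
  have hsS : ∀ n ∈ S, s ∈ S := by
    rcases hS with rfl | rfl
    · intro n hn
      rw [mem_Icc] at hn ⊢
      omega
    · exact fun n _ => mem_univ _
  have hIio : s ∉ Iio s := by simp
  have hIoi : s ∉ Ioi s := by simp
  refine ⟨fun k hk t ht => ?_, fun k hk t ht => hsymm.hDown_reflect hQ hrefl (hsS k hk) hk ht.le,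
    fun i hi => ?_, fun j hj => ?_⟩
  · have hs := hsS k hk
    have h1 := hQ.summable_current hk hs hIio ht.le
    have h2 := hQ.summable_current hk hs hIoi ht.le
    rw [MarkovChain.indicator_Iio_eq hk s ht.le, ← summable_subtype_iff_indicator] at h1
    rw [MarkovChain.indicator_Ioi_eq hk s ht.le, ← summable_subtype_iff_indicator] at h2
    rw [MarkovChain.hUp_eq_current hk s ht.le, MarkovChain.hDown_eq_current hk s ht.le]
    refine ⟨h1, h2, (hQ.tendsto_flux_div hk hs hIio ht.le).congr fun τ => ?_,
      (hQ.tendsto_flux_div hk hs hIoi ht.le).congr fun τ => ?_⟩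
    · simp only [MarkovChain.flux, mem_Iio, and_comm]
    · simp only [MarkovChain.flux, mem_Ioi, and_comm]
  · obtain ⟨h1, h2⟩ := MarkovChain.isPassageDensity_g hQ hsymm hrefl (hsS i hi.1)
      hsep.sides_below hi.1 hi.2
    refine ⟨h1, fun t ht => ?_⟩
    rw [h2 t ht, MarkovChain.hUp_eq_current hi.1 s ht.le, MarkovChain.hDown_eq_current hi.1 s ht.le]
  · obtain ⟨h1, h2⟩ := MarkovChain.isPassageDensity_g hQ hsymm hrefl (hsS j hj.1)
      hsep.sides_above hj.1 hj.2
    refine ⟨h1, fun t ht => ?_⟩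
    rw [h2 t ht, MarkovChain.hUp_eq_current hj.1 s ht.le, MarkovChain.hDown_eq_current hj.1 s ht.le]
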